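/- Let $F$ be a totally real number field with ring of integers $\mathcal O$ and class group $\mathrm{cl}(F)$, let $B$ be a totally definite quaternion algebra over $F$ (that is, $B\otimes_{F,\tau}\mathbb R$ is a division algebra for every embedding $\tau:F\to\mathbb R$) with reduced norm $N$, and let $R$ be an Eichler order in $B$ (an intersection of two maximal orders). Let $\mathfrak I(R)$ be the set of locally principal left $R$-ideals, i.e. of the $\mathcal O$-lattices $I\subset B$ with $RI\subseteq I$ that are locally, at each prime $\mathfrak p$ of $\mathcal O$, of the form $R_{\mathfrak p}x_{\mathfrak p}$. Let $\mathrm{cl}(R)$ be the finite set of classes $[I]$ of such ideals, where $[I]=[J]$ if and only if $I=Jx$ for some $x\in B^\times$. Let $M(R)$ be the complex vector space with basis $\mathrm{cl}(R)$, with the (Hermitian) inner product determined by $$\langle [I],[J]\rangle=\#\{x\in\mathcal O^\times\backslash B^\times : Ix=J\}.$$ For $I\in\mathfrak I(R)$ let $N(I)$ be the fractional ideal of $F$ generated by the reduced norms of the elements of $I$. For each class $[\mathfrak a]\in\mathrm{cl}(F)$ let $$e_{[\mathfrak a]}=\sum_{[I]\in\mathrm{cl}(R),\ [N(I)]=[\mathfrak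 a]}\frac{1}{\langle [I],[I]\rangle}\,[I]\in M(R).$$ Let $E(R)$ be the subspace of $M(R)$ spanned by the vectors $e_{[\mathfrak a]}$, $[\mathfrak a]\in\mathrm{cl}(F)$, and let $S(R)$ be the orthogonal complement of $E(R)$ in $M(R)$. For a nonzero ideal $\mathfrak m$ of $\mathcal O$ let $T_{\mathfrak m}$ be the linear operator on $M(R)$ with $$T_{\mathfrak m}([I])=\sum_{J\in\mathfrak I(R),\ J\subseteq I,\ [I:J]=\mathfrak m^2}[J],$$ where the index $[I:J]$ is the ideal of $\mathcal O$ generated by the determinants of the $F$-linear maps $\delta:B\to B$ with $\delta(I)\subseteq J$. Let $\mathrm{cl}(F)$ act linearly on $M(R)$ by $[\mathfrak a]\cdot[I]=[\mathfrak aI]$ for fractional ideals $\mathfrak a$ of $F$, where $\mathfrak aI$ is the lattice generated by the products of elements of $\mathfrak a$ and of $I$. Then for every nonzero ideal $\mathfrak m$ of $\mathcal O$ we have $T_{\mathfrak m}(E(R))\subseteq E(R)$ and $T_{\mathfrak m}(S(R))\subseteq S(R)$, and for every class $[\mathfrak a]\in\mathrm{cl}(F)$ we have $[\mathfrak a]\cdot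 E(R)\subseteq E(R)$ and $[\mathfrak a]\cdot S(R)\subseteq S(R)$. -/

import Mathlib

open NumberField IsDedekindDomain
open scoped TensorProduct Quaternion nonZeroDivisors

set_option linter.unusedSectionVars false

noncomputable section

namespace QuatForms

/-! ### Quaternion algebras -/

section Algebra

variable (F B : Type*) [Field F] [Ring B] [Algebra F B]

/-- `B` is a quaternion algebra over `F` (characteristic different from `2`): it has a basis
`1, i, j, ij` with `i² = a`, `j² = b`, `ij = -ji` for some nonzero `a, b` in `F`. -/
def IsQuaternionAlgebra : Prop :=
  ∃ a b : F, a ≠ 0 ∧ b ≠ 0 ∧ Nonempty (B ≃ₐ[F] ℍ[F, a, b])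

/-- Total definiteness: for every embedding `τ : F → ℝ` the algebra `ℝ ⊗_{F, τ} B` is a division
algebra, i.e. `B` is ramified at `τ`. -/
def IsTotallyDefinite : Prop :=
  ∀ τ : F →+* ℝ, letI : Algebra F ℝ := τ.toAlgebra
    ∀ z : ℝ ⊗[F] B, z ≠ 0 → IsUnit z

variable {B}

/-- The reduced trace of a quaternion algebra: half of the trace of left multiplication. -/
def reducedTrace (x : B) : F := LinearMap.trace F B (LinearMap.mulLeft F x) / 2

/-- The reduced norm of a quaternion algebra, from `trd(x²) = trd(x)² - 2 nrd(x)`. -/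
def reducedNorm (x : B) : F := (reducedTrace F x ^ 2 - reducedTrace F (x ^ 2)) / 2

end Algebra

variable {F B : Type*} [Field F] [NumberField F] [Ring B] [Algebra F B]

/-! ### Orders -/

/-- An order of `B`: a subring containing `𝓞 F` that is an `𝓞 F`-lattice in `B`. -/
def IsOrder (R : Subalgebra (𝓞 F) B) : Prop :=
  Submodule.IsLattice F (Subalgebra.toSubmodule R)

/-- A maximal order. -/
def IsMaximalOrder (R : Subalgebra (𝓞 F) B) : Prop := Maximal IsOrder R

/-- An Eichler order: the intersection of two maximal orders. -/
def IsEichlerOrder (R : Subalgebra (𝓞 F) B) : Prop :=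
  ∃ R₁ R₂ : Subalgebra (𝓞 F) B, IsMaximalOrder R₁ ∧ IsMaximalOrder R₂ ∧ R = R₁ ⊓ R₂

/-! ### Lattices: localization, right translation, products with fractional ideals -/

/-- The localization `I_(p)` of an `𝓞 F`-submodule of `B` at the prime `p`, inside `B`. -/
def localize (p : HeightOneSpectrum (𝓞 F)) (I : Submodule (𝓞 F) B) : Submodule (𝓞 F) B where
  carrier := {b | ∃ s : 𝓞 F, s ∉ p.asIdeal ∧ s • b ∈ I}
  zero_mem' := ⟨1, fun h => p.isPrime.ne_top ((Ideal.eq_top_iff_one _).2 h), by simp⟩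
  add_mem' := by
    rintro a b ⟨s, hs, ha⟩ ⟨t, ht, hb⟩
    refine ⟨s * t, fun h => (p.isPrime.mem_or_mem h).elim hs ht, ?_⟩
    rw [smul_add]
    refine I.add_mem ?_ ?_
    · rw [mul_comm, mul_smul]; exact I.smul_mem _ ha
    · rw [mul_smul]; exact I.smul_mem _ hb
  smul_mem' := by
    rintro c b ⟨s, hs, hb⟩
    exact ⟨s, hs, by rw [smul_comm]; exact I.smul_mem _ hb⟩

/-- The right translate `I x = {y x : y ∈ I}`. -/
def rtrans (I : Submodule (𝓞 F) B) (x : B) : Submodule (𝓞 F) B :=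
  I * Submodule.span (𝓞 F) {x}

theorem mem_rtrans {I : Submodule (𝓞 F) B} {x b : B} :
    b ∈ rtrans I x ↔ ∃ y ∈ I, y * x = b :=
  Submodule.mem_mul_span_singleton

theorem rtrans_rtrans (I : Submodule (𝓞 F) B) (x y : B) :
    rtrans (rtrans I x) y = rtrans I (x * y) := by
  simp [rtrans, mul_assoc, Submodule.span_mul_span]

theorem rtrans_one (I : Submodule (𝓞 F) B) : rtrans I 1 = I := by
  ext b; simp [mem_rtrans]

theorem rtrans_mono {I J : Submodule (𝓞 F) B} (h : I ≤ J) (x : B) : rtrans I x ≤ rtrans J x :=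
  mul_le_mul' h le_rfl

theorem localize_mono (p : HeightOneSpectrum (𝓞 F)) {I J : Submodule (𝓞 F) B} (h : I ≤ J) :
    localize p I ≤ localize p J :=
  fun _ ⟨s, hs, hb⟩ => ⟨s, hs, h hb⟩

theorem localize_rtrans (p : HeightOneSpectrum (𝓞 F)) (I : Submodule (𝓞 F) B) (x : Bˣ) :
    localize p (rtrans I x) = rtrans (localize p I) x := by
  ext b
  simp only [mem_rtrans]
  constructor
  · rintro ⟨s, hs, hb⟩
    obtain ⟨y, hy, h⟩ := mem_rtrans.1 hb
    refine ⟨b * ↑x⁻¹, ⟨s, hs, ?_⟩, by simp⟩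
    rw [← smul_mul_assoc, ← h]
    simpa using hy
  · rintro ⟨y, ⟨s, hs, hy⟩, rfl⟩
    exact ⟨s, hs, mem_rtrans.2 ⟨s • y, hy, by simp⟩⟩

theorem isLattice_rtrans {I : Submodule (𝓞 F) B} (hI : Submodule.IsLattice F I) (x : Bˣ) :
    Submodule.IsLattice F (rtrans I (x : B)) where
  fg := hI.fg.mul (Submodule.fg_span_singleton _)
  span_eq_top := by
    rw [eq_top_iff]
    intro b _
    have hb : b * ↑x⁻¹ ∈ Submodule.span F (I : Set B) := by rw [hI.span_eq_top]; trivial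
    have h := Submodule.mem_map_of_mem (f := LinearMap.mulRight F (x : B)) hb
    rw [Submodule.map_span] at h
    simp only [LinearMap.mulRight_apply, Units.inv_mul_cancel_right] at h
    refine Submodule.span_mono ?_ h
    rintro _ ⟨y, hy, rfl⟩
    exact mem_rtrans.2 ⟨y, hy, rfl⟩

/-- The product `𝔞 I`, the `𝓞 F`-submodule of `B` generated by the products `α y` with
`α ∈ 𝔞 ⊆ F` and `y ∈ I`. -/
def idealMul (𝔞 : Submodule (𝓞 F) F) (I : Submodule (𝓞 F) B) : Submodule (𝓞 F) B :=
  𝔞.map (IsScalarTower.toAlgHom (𝓞 F) F B).toLinearMap * I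

theorem idealMul_mul (𝔞 𝔟 : Submodule (𝓞 F) F) (I : Submodule (𝓞 F) B) :
    idealMul (𝔞 * 𝔟) I = idealMul 𝔞 (idealMul 𝔟 I) := by
  simp only [idealMul, Submodule.map_mul, mul_assoc]

theorem idealMul_one (I : Submodule (𝓞 F) B) : idealMul (1 : Submodule (𝓞 F) F) I = I := by
  simp [idealMul, Submodule.map_one]

theorem idealMul_mono {𝔞 𝔟 : Submodule (𝓞 F) F} {I J : Submodule (𝓞 F) B} (h : 𝔞 ≤ 𝔟)
    (h' : I ≤ J) : idealMul 𝔞 I ≤ idealMul 𝔟 J :=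
  mul_le_mul' (Submodule.map_mono h) h'

theorem idealMul_rtrans (𝔞 : Submodule (𝓞 F) F) (I : Submodule (𝓞 F) B) (x : B) :
    idealMul 𝔞 (rtrans I x) = rtrans (idealMul 𝔞 I) x := by
  simp only [idealMul, rtrans, mul_assoc]

/-- A nonzero scalar as a unit of `B`. -/
def scalarUnit : Fˣ →* Bˣ := Units.map (algebraMap F B : F →* B)

theorem idealMul_span_singleton (ξ : Fˣ) (I : Submodule (𝓞 F) B) :
    idealMul (Submodule.span (𝓞 F) {(ξ : F)}) I = rtrans I (scalarUnit (B := B) ξ : B) := by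
  ext b
  rw [idealMul, Submodule.map_span, Set.image_singleton, Submodule.mem_span_singleton_mul,
    mem_rtrans]
  have h : ∀ z : B, (IsScalarTower.toAlgHom (𝓞 F) F B).toLinearMap (ξ : F) * z =
      z * (scalarUnit (B := B) ξ : B) := fun z => Algebra.commutes (ξ : F) z
  simp only [h]

theorem idealMul_left_mul (𝔞 : Submodule (𝓞 F) F) (M I : Submodule (𝓞 F) B) :
    M * idealMul 𝔞 I = idealMul 𝔞 (M * I) := by
  have h : M * 𝔞.map (IsScalarTower.toAlgHom (𝓞 F) F B).toLinearMap =
      𝔞.map (IsScalarTower.toAlgHom (𝓞 F) F B).toLinearMap * M := by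
    apply Submodule.mul_comm_of_commute
    rintro m _ _ ⟨α, _, rfl⟩
    exact (Algebra.commutes (α : F) m).symm
  rw [idealMul, ← mul_assoc, h, mul_assoc]; rfl

/-- A fractional ideal is locally generated by one nonzero element. -/
theorem exists_local_generator (p : HeightOneSpectrum (𝓞 F)) (𝔞 : (FractionalIdeal (𝓞 F)⁰ F)ˣ) :
    ∃ (ξ : Fˣ) (s : 𝓞 F), s ∉ p.asIdeal ∧
      Submodule.span (𝓞 F) {(ξ : F)} ≤ ((𝔞 : FractionalIdeal (𝓞 F)⁰ F) : Submodule (𝓞 F) F) ∧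
      ∀ α ∈ ((𝔞 : FractionalIdeal (𝓞 F)⁰ F) : Submodule (𝓞 F) F),
        s • α ∈ Submodule.span (𝓞 F) {(ξ : F)} := by
  set A : Submodule (𝓞 F) F := ((𝔞 : FractionalIdeal (𝓞 F)⁰ F) : Submodule (𝓞 F) F) with hA
  set A' : Submodule (𝓞 F) F :=
    (((𝔞⁻¹ : (FractionalIdeal (𝓞 F)⁰ F)ˣ) : FractionalIdeal (𝓞 F)⁰ F) : Submodule (𝓞 F) F)
    with hA'
  have hmul : A * A' = 1 := by
    rw [hA, hA', ← FractionalIdeal.coe_mul, Units.mul_inv, FractionalIdeal.coe_one]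
  have hint : ∀ α ∈ A, ∀ η ∈ A', ∃ s : 𝓞 F, algebraMap (𝓞 F) F s = α * η := by
    intro α hα η hη
    have h : α * η ∈ A * A' := Submodule.mul_mem_mul hα hη
    rw [hmul] at h
    exact Submodule.mem_one.1 h
  have hex : ∃ α ∈ A, ∃ η ∈ A', ∃ s : 𝓞 F, s ∉ p.asIdeal ∧ algebraMap (𝓞 F) F s = α * η := by
    by_contra hcon
    push Not at hcon
    have hle : A * A' ≤ Submodule.map (Algebra.linearMap (𝓞 F) F) p.asIdeal := by
      refine Submodule.mul_le.2 fun α hα η hη => ?_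
      obtain ⟨s, hs⟩ := hint α hα η hη
      refine ⟨s, ?_, hs⟩
      by_contra hsp
      exact hcon α hα η hη s hsp hs
    rw [hmul] at hle
    obtain ⟨t, ht, h1⟩ := hle (Submodule.mem_one.2 ⟨1, map_one _⟩)
    have : t = 1 := FaithfulSMul.algebraMap_injective (𝓞 F) F (by simpa using h1)
    subst this
    exact p.isPrime.ne_top ((Ideal.eq_top_iff_one _).2 ht)
  obtain ⟨ξ, hξ, η, hη, s, hs, hsξ⟩ := hex
  have hξ0 : ξ ≠ 0 := by
    rintro rfl
    rw [zero_mul] at hsξ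
    have : s = 0 := FaithfulSMul.algebraMap_injective (𝓞 F) F (by simpa using hsξ)
    exact hs (this ▸ p.asIdeal.zero_mem)
  refine ⟨Units.mk0 ξ hξ0, s, hs, ?_, fun α hα => ?_⟩
  · rw [Submodule.span_le, Set.singleton_subset_iff]; exact hξ
  · obtain ⟨t, ht⟩ := hint α hα η hη
    refine Submodule.mem_span_singleton.2 ⟨t, ?_⟩
    rw [Algebra.smul_def, Algebra.smul_def, hsξ, ht, Units.val_mk0]
    ring

/-- Locally `𝔞 I` is `I_(p) ξ`, where `ξ` is a local generator of `𝔞`. -/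
theorem exists_localize_idealMul (p : HeightOneSpectrum (𝓞 F))
    (𝔞 : (FractionalIdeal (𝓞 F)⁰ F)ˣ) :
    ∃ ξ : Fˣ, ∀ I : Submodule (𝓞 F) B,
      localize p (idealMul ((𝔞 : FractionalIdeal (𝓞 F)⁰ F) : Submodule (𝓞 F) F) I) =
        rtrans (localize p I) (scalarUnit (B := B) ξ : B) := by
  obtain ⟨ξ, s, hs, h₁, h₂⟩ := exists_local_generator p 𝔞
  refine ⟨ξ, fun I => ?_⟩
  rw [← localize_rtrans, ← idealMul_span_singleton]
  refine le_antisymm ?_ (localize_mono p (idealMul_mono h₁ le_rfl))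
  rintro b ⟨t, ht, hb⟩
  refine ⟨s * t, fun h => (p.isPrime.mem_or_mem h).elim hs ht, ?_⟩
  rw [mul_smul]
  generalize t • b = c at hb
  induction hb using Submodule.mul_induction_on' with
  | mem_mul_mem m hm n hn =>
    obtain ⟨α, hα, rfl⟩ := hm
    rw [← smul_mul_assoc, ← map_smul]
    exact Submodule.mul_mem_mul (Submodule.mem_map_of_mem (h₂ α hα)) hn
  | add x _ y _ hx hy => rw [smul_add]; exact Submodule.add_mem _ hx hy

theorem isLattice_idealMul (𝔞 : (FractionalIdeal (𝓞 F)⁰ F)ˣ) {I : Submodule (𝓞 F) B}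
    (hI : Submodule.IsLattice F I) :
    Submodule.IsLattice F
      (idealMul ((𝔞 : FractionalIdeal (𝓞 F)⁰ F) : Submodule (𝓞 F) F) I) where
  fg := ((FractionalIdeal.fg_unit 𝔞).map _).mul hI.fg
  span_eq_top := by
    have hne : ∃ α ∈ ((𝔞 : FractionalIdeal (𝓞 F)⁰ F) : Submodule (𝓞 F) F), α ≠ 0 := by
      by_contra hcon
      push Not at hcon
      refine 𝔞.ne_zero (FractionalIdeal.coeToSubmodule_injective ?_)
      exact ((Submodule.eq_bot_iff _).2 hcon).trans FractionalIdeal.coe_zero.symm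
    obtain ⟨α, hα, hα0⟩ := hne
    have hle : idealMul (Submodule.span (𝓞 F) {((Units.mk0 α hα0 : Fˣ) : F)}) I ≤
        idealMul ((𝔞 : FractionalIdeal (𝓞 F)⁰ F) : Submodule (𝓞 F) F) I :=
      idealMul_mono (by rw [Submodule.span_le, Set.singleton_subset_iff]; exact hα) le_rfl
    rw [idealMul_span_singleton] at hle
    rw [eq_top_iff, ← (isLattice_rtrans hI (scalarUnit (Units.mk0 α hα0))).span_eq_top]
    exact Submodule.span_mono hle

/-! ### Index and norm ideals -/

/-- The index `[I : J]` of `𝓞 F`-lattices: the `𝓞 F`-submodule of `F` generated by the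
determinants of the `F`-linear endomorphisms `δ` of `B` with `δ(I) ⊆ J`. If `J ⊆ I`, it is the
integral ideal that is locally generated by the determinant of an `F`-linear map taking `I_(p)`
onto `J_(p)`. -/
def indexIdeal (I J : Submodule (𝓞 F) B) : Submodule (𝓞 F) F :=
  Submodule.span (𝓞 F) {c | ∃ δ : B →ₗ[F] B, (∀ y ∈ I, δ y ∈ J) ∧ LinearMap.det δ = c}

theorem indexIdeal_rtrans_le (I J : Submodule (𝓞 F) B) (x : Bˣ) :
    indexIdeal I J ≤ indexIdeal (rtrans I x) (rtrans J x) := by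
  refine Submodule.span_mono ?_
  rintro _ ⟨δ, hδ, rfl⟩
  let e : B ≃ₗ[F] B := LinearEquiv.ofLinearMap (LinearMap.mulRight F (x : B))
    (LinearMap.mulRight F ((x⁻¹ : Bˣ) : B)) (by ext; simp) (by ext; simp)
  refine ⟨(e : B →ₗ[F] B) ∘ₗ δ ∘ₗ (e.symm : B →ₗ[F] B), ?_, LinearMap.det_conj δ e⟩
  intro b hb
  obtain ⟨y, hy, rfl⟩ := mem_rtrans.1 hb
  refine mem_rtrans.2 ⟨δ y, hδ y hy, ?_⟩
  have : e.symm (y * x) = y := e.symm_apply_apply y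
  simp only [LinearMap.comp_apply, LinearEquiv.coe_coe, this]
  rfl

theorem indexIdeal_rtrans (I J : Submodule (𝓞 F) B) (x : Bˣ) :
    indexIdeal (rtrans I x) (rtrans J x) = indexIdeal I J := by
  refine le_antisymm ?_ (indexIdeal_rtrans_le I J x)
  have h := indexIdeal_rtrans_le (rtrans I (x : B)) (rtrans J (x : B)) x⁻¹
  simpa only [rtrans_rtrans, Units.mul_inv, rtrans_one] using h

/-- The norm `N(I)`: the `𝓞 F`-submodule of `F` generated by the reduced norms of the elements
of `I`. -/
def normIdeal (I : Submodule (𝓞 F) B) : Submodule (𝓞 F) F :=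
  Submodule.span (𝓞 F) (reducedNorm F '' (I : Set B))

/-! ### Invertible left ideals and their classes -/

/-- The set `𝔍(R)` of invertible, i.e. locally principal, left `R`-ideals. -/
@[ext]
structure InvIdeal (R : Subalgebra (𝓞 F) B) where
  /-- The underlying lattice. -/
  carrier : Submodule (𝓞 F) B
  isLattice : Submodule.IsLattice F carrier
  mul_le : Subalgebra.toSubmodule R * carrier ≤ carrier
  locallyPrincipal : ∀ p : HeightOneSpectrum (𝓞 F), ∃ x : Bˣ,
    localize p carrier = rtrans (localize p (Subalgebra.toSubmodule R)) x

variable {R : Subalgebra (𝓞 F) B}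

/-- The ideal `I x`. -/
def InvIdeal.rmul (I : InvIdeal R) (x : Bˣ) : InvIdeal R where
  carrier := rtrans I.carrier x
  isLattice := isLattice_rtrans I.isLattice x
  mul_le := by
    rw [rtrans, ← mul_assoc]
    exact mul_le_mul' I.mul_le le_rfl
  locallyPrincipal p := by
    obtain ⟨y, hy⟩ := I.locallyPrincipal p
    exact ⟨y * x, by rw [localize_rtrans, hy, rtrans_rtrans, Units.val_mul]⟩

theorem InvIdeal.rmul_rmul (I : InvIdeal R) (x y : Bˣ) : (I.rmul x).rmul y = I.rmul (x * y) :=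
  InvIdeal.ext (by simp [InvIdeal.rmul, rtrans_rtrans])

theorem InvIdeal.rmul_one (I : InvIdeal R) : I.rmul 1 = I :=
  InvIdeal.ext (by simp [InvIdeal.rmul, rtrans_one])

theorem InvIdeal.rmul_eq_iff (I J : InvIdeal R) (x : Bˣ) : I.rmul x = J ↔ I = J.rmul x⁻¹ := by
  constructor
  · rintro rfl; rw [rmul_rmul, mul_inv_cancel, rmul_one]
  · rintro rfl; rw [rmul_rmul, inv_mul_cancel, rmul_one]

/-- The ideal `𝔞 I`. -/
def InvIdeal.smulIdeal (𝔞 : (FractionalIdeal (𝓞 F)⁰ F)ˣ) (I : InvIdeal R) : InvIdeal R where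
  carrier := idealMul ((𝔞 : FractionalIdeal (𝓞 F)⁰ F) : Submodule (𝓞 F) F) I.carrier
  isLattice := isLattice_idealMul 𝔞 I.isLattice
  mul_le := by
    rw [idealMul_left_mul]
    exact idealMul_mono le_rfl I.mul_le
  locallyPrincipal p := by
    obtain ⟨y, hy⟩ := I.locallyPrincipal p
    obtain ⟨ξ, hξ⟩ := exists_localize_idealMul (B := B) p 𝔞
    exact ⟨y * scalarUnit ξ, by rw [hξ, hy, rtrans_rtrans, Units.val_mul]⟩

variable (R)

/-- Two ideals `I, J` are equivalent if `I = J x` for some `x` in `Bˣ`. -/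
def idealSetoid : Setoid (InvIdeal R) where
  r I J := ∃ x : Bˣ, I = J.rmul x
  iseqv :=
    { refl := fun I => ⟨1, I.rmul_one.symm⟩
      symm := by
        rintro I J ⟨x, rfl⟩
        exact ⟨x⁻¹, by rw [InvIdeal.rmul_rmul, mul_inv_cancel, InvIdeal.rmul_one]⟩
      trans := by
        rintro I J K ⟨x, rfl⟩ ⟨y, rfl⟩
        exact ⟨y * x, by rw [InvIdeal.rmul_rmul]⟩ }

/-- The set `cl(R)` of classes of invertible left `R`-ideals. It is finite if `R` is an order in
a quaternion algebra. -/
def ClassSet : Type _ := Quotient (idealSetoid R)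

variable {R}

/-- The class `[I]`. -/
def InvIdeal.toClass (I : InvIdeal R) : ClassSet R := Quotient.mk (idealSetoid R) I

variable (R)

/-- The space `M(R)` of quaternionic modular forms: the complex vector space on `cl(R)`. -/
abbrev ModularForms : Type _ := ClassSet R →₀ ℂ

/-! ### The inner product -/

variable (F B) in
/-- The subgroup `(𝓞 F)ˣ` of `Bˣ`. -/
def integerUnits : Subgroup Bˣ :=
  (Units.map (algebraMap (𝓞 F) B : 𝓞 F →* B)).range

instance : (integerUnits F B).Normal where
  conj_mem := by
    rintro _ ⟨u, rfl⟩ g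
    have h : g * Units.map (algebraMap (𝓞 F) B : 𝓞 F →* B) u =
        Units.map (algebraMap (𝓞 F) B : 𝓞 F →* B) u * g :=
      Units.ext (Algebra.commutes (u : 𝓞 F) (g : B)).symm
    rw [h, mul_inv_cancel_right]
    exact ⟨u, rfl⟩

variable {R}

/-- The number of `x` in `(𝓞 F)ˣ \ Bˣ` with `I x = J`. Since `(𝓞 F)ˣ` is central in `Bˣ`, left
and right cosets agree. For an order `R` of a totally definite quaternion algebra over a totally
real field this number is finite. -/
def pairCount (I J : InvIdeal R) : ℕ :=
  Set.ncard ((QuotientGroup.mk : Bˣ → Bˣ ⧸ integerUnits F B) '' {x | I.rmul x = J})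

theorem pairCount_rmul (I J : InvIdeal R) (y z : Bˣ) :
    pairCount (I.rmul y) (J.rmul z) = pairCount I J := by
  have h : (QuotientGroup.mk : Bˣ → Bˣ ⧸ integerUnits F B) ''
        {x | (I.rmul y).rmul x = J.rmul z} =
      (fun c : Bˣ ⧸ integerUnits F B => (y⁻¹ : Bˣ) * c * (z : Bˣ)) ''
        ((QuotientGroup.mk : Bˣ → Bˣ ⧸ integerUnits F B) '' {x | I.rmul x = J}) := by
    rw [Set.image_image]
    ext c
    constructor
    · rintro ⟨x, hx, rfl⟩
      refine ⟨y * x * z⁻¹, ?_, ?_⟩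
      · rw [Set.mem_ofPred_eq, InvIdeal.rmul_rmul] at hx
        rw [Set.mem_ofPred_eq, ← InvIdeal.rmul_rmul, hx, InvIdeal.rmul_rmul, mul_inv_cancel,
          InvIdeal.rmul_one]
      · simp [mul_assoc]
    · rintro ⟨x, hx, rfl⟩
      refine ⟨y⁻¹ * x * z, ?_, by simp⟩
      rw [Set.mem_ofPred_eq] at hx
      rw [Set.mem_ofPred_eq, InvIdeal.rmul_rmul, ← hx, InvIdeal.rmul_rmul]
      simp [mul_assoc]
  rw [pairCount, h, Set.ncard_image_of_injective]
  · rfl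
  · intro c d hcd
    simpa using hcd

/-- The value `⟨[I], [J]⟩`, the number of `x` in `(𝓞 F)ˣ \ Bˣ` with `I x = J`. -/
def classPair : ClassSet R → ClassSet R → ℕ :=
  Quotient.lift₂ pairCount (by
    rintro I J I' J' ⟨y, rfl⟩ ⟨z, rfl⟩
    exact pairCount_rmul I' J' y z)

variable (R)

/-- The inner product on `M(R)`, conjugate-linear in the first variable, with
`⟨[I], [J]⟩ = #{x ∈ (𝓞 F)ˣ \ Bˣ : I x = J}`. -/
def innerForm : ModularForms R →ₗ⋆[ℂ] ModularForms R →ₗ[ℂ] ℂ :=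
  LinearMap.mk₂'ₛₗ (starRingEnd ℂ) (RingHom.id ℂ)
    (fun v w => v.sum fun c a => w.sum fun d b => starRingEnd ℂ a * b * (classPair c d : ℂ))
    (fun v v' w => by
      refine Finsupp.sum_add_index' (fun c => by simp) (fun c a a' => ?_)
      rw [← Finsupp.sum_add]
      simp only [map_add, add_mul])
    (fun t v w => by
      rw [Finsupp.sum_smul_index' (fun c => by simp), smul_eq_mul, Finsupp.mul_sum]
      simp only [smul_eq_mul, map_mul, Finsupp.mul_sum, mul_assoc])
    (fun v w w' => by
      rw [← Finsupp.sum_add]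
      refine Finsupp.sum_congr fun c _ => ?_
      exact Finsupp.sum_add_index' (fun d => by simp) (fun d b b' => by ring))
    (fun t v w => by
      simp only [RingHom.id_apply, smul_eq_mul, Finsupp.mul_sum]
      refine Finsupp.sum_congr fun c _ => ?_
      rw [Finsupp.sum_smul_index' (fun d => by simp)]
      refine Finsupp.sum_congr fun d _ => ?_
      rw [smul_eq_mul]; ring)

/-! ### Eisenstein subspace and cusp forms -/

/-- The set `cl_A(R)` of the classes `[I]` whose norm `N(I)` is a fractional ideal in the class
`A` of `cl(F)`. -/
def normClass (A : ClassGroup (𝓞 F)) : Set (ClassSet R) :=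
  {c | ∃ I : InvIdeal R, I.toClass = c ∧ ∃ 𝔞 : (FractionalIdeal (𝓞 F)⁰ F)ˣ,
    normIdeal I.carrier = ((𝔞 : FractionalIdeal (𝓞 F)⁰ F) : Submodule (𝓞 F) F) ∧
    ClassGroup.mk (K := F) 𝔞 = A}

/-- The vector `e_A`, the sum of `[I] / ⟨[I], [I]⟩` over the classes `[I]` in
the finite set `cl_A(R)`. -/
def eisVector (A : ClassGroup (𝓞 F)) : ModularForms R :=
  ∑ᶠ c ∈ normClass R A, Finsupp.single c (1 / (classPair c c : ℂ))

/-- The space `E(R)` spanned by the vectors `e_A`. -/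
def eisSpace : Submodule ℂ (ModularForms R) := Submodule.span ℂ (Set.range (eisVector R))

/-- The space `S(R)` of quaternionic cusp forms, the orthogonal complement of `E(R)`. -/
def cuspSpace : Submodule ℂ (ModularForms R) := (eisSpace R).orthogonalBilin (innerForm R)

/-! ### Hecke operators -/

variable {R}

/-- The set `t_𝔪(I)` of the invertible left `R`-ideals `J ⊆ I` with `[I : J] = 𝔪²`. -/
def heckeSet (𝔪 : Ideal (𝓞 F)) (I : InvIdeal R) : Set (InvIdeal R) :=
  {J | J.carrier ≤ I.carrier ∧
    indexIdeal I.carrier J.carrier = Submodule.map (Algebra.linearMap (𝓞 F) F) (𝔪 ^ 2)}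

theorem rmul_mem_heckeSet {𝔪 : Ideal (𝓞 F)} {I J : InvIdeal R} (h : J ∈ heckeSet 𝔪 I) (x : Bˣ) :
    J.rmul x ∈ heckeSet 𝔪 (I.rmul x) :=
  ⟨rtrans_mono h.1 x, (indexIdeal_rtrans I.carrier J.carrier x).trans h.2⟩

/-- The sum of the classes `[J]` over the (finite) set of all `J` in `t_𝔪(I)`. -/
def heckeSum (𝔪 : Ideal (𝓞 F)) (I : InvIdeal R) : ModularForms R :=
  ∑ᶠ J ∈ heckeSet 𝔪 I, Finsupp.single J.toClass 1

theorem heckeSum_rmul (𝔪 : Ideal (𝓞 F)) (I : InvIdeal R) (x : Bˣ) :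
    heckeSum 𝔪 (I.rmul x) = heckeSum 𝔪 I := by
  symm
  refine finsum_mem_eq_of_bijOn (fun J => J.rmul x) ⟨fun J hJ => rmul_mem_heckeSet hJ x,
    fun J _ K _ h => ?_, fun K hK => ⟨K.rmul x⁻¹, ?_, ?_⟩⟩ fun J _ => ?_
  · have := congrArg (fun L : InvIdeal R => L.rmul x⁻¹) h
    simpa only [InvIdeal.rmul_rmul, mul_inv_cancel, InvIdeal.rmul_one] using this
  · have := rmul_mem_heckeSet hK x⁻¹
    rwa [InvIdeal.rmul_rmul, mul_inv_cancel, InvIdeal.rmul_one] at this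
  · simp only [InvIdeal.rmul_rmul, inv_mul_cancel, InvIdeal.rmul_one]
  · have : (J.rmul x).toClass = J.toClass := Quotient.sound ⟨x, rfl⟩
    rw [this]

variable (R)

/-- The Hecke operator `T_𝔪` on `M(R)`, with `T_𝔪([I])` the sum of the `[J]`, `J` in `t_𝔪(I)`. -/
def heckeOp (𝔪 : Ideal (𝓞 F)) : ModularForms R →ₗ[ℂ] ModularForms R :=
  Finsupp.linearCombination ℂ (Quotient.lift (s := idealSetoid R) (heckeSum 𝔪) (by
    rintro I J ⟨x, rfl⟩
    exact heckeSum_rmul 𝔪 J x) : ClassSet R → ModularForms R)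

/-! ### The action of the class group -/

/-- The action of the group of fractional ideals on `cl(R)`, `𝔞 [I] = [𝔞 I]`. -/
def fracAct : (FractionalIdeal (𝓞 F)⁰ F)ˣ →* Function.End (ClassSet R) where
  toFun 𝔞 := Quotient.map' (s₁ := idealSetoid R) (s₂ := idealSetoid R) (InvIdeal.smulIdeal 𝔞) (by
    rintro I J ⟨x, rfl⟩
    exact ⟨x, InvIdeal.ext (idealMul_rtrans _ J.carrier x)⟩)
  map_one' := by
    funext c
    induction c using Quotient.inductionOn with
    | h I =>
      refine congrArg (Quotient.mk (idealSetoid R)) (InvIdeal.ext ?_)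
      simp [InvIdeal.smulIdeal, idealMul_one]
  map_mul' 𝔞 𝔟 := by
    funext c
    induction c using Quotient.inductionOn with
    | h I =>
      refine congrArg (Quotient.mk (idealSetoid R)) (InvIdeal.ext ?_)
      simp [InvIdeal.smulIdeal, idealMul_mul]

/-- The induced action of `cl(F)` on `cl(R)`: principal ideals act trivially. -/
def classAct : ClassGroup (𝓞 F) →* Function.End (ClassSet R) :=
  (QuotientGroup.lift (toPrincipalIdeal (𝓞 F) F).range (fracAct R) (by
    rintro _ ⟨ξ, rfl⟩
    funext c
    induction c using Quotient.inductionOn with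
    | h I =>
      refine Quotient.sound ⟨scalarUnit ξ, InvIdeal.ext ?_⟩
      have h : ((toPrincipalIdeal (𝓞 F) F ξ : FractionalIdeal (𝓞 F)⁰ F) : Submodule (𝓞 F) F) =
          Submodule.span (𝓞 F) {(ξ : F)} := by
        rw [coe_toPrincipalIdeal, FractionalIdeal.coe_spanSingleton]
      exact (congrArg (fun M => idealMul M I.carrier) h).trans
        (idealMul_span_singleton ξ I.carrier))).comp
    (ClassGroup.equiv F).toMonoidHom

/-- The action of `cl(F)` on `M(R)`: the linear extension of its action on `cl(R)`. -/
def classOp : ClassGroup (𝓞 F) →* Module.End ℂ (ModularForms R) where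
  toFun A := Finsupp.lmapDomain ℂ ℂ (classAct R A)
  map_one' := by
    rw [map_one]
    exact Finsupp.lmapDomain_id ℂ ℂ
  map_mul' A A' := by
    rw [map_mul]
    exact Finsupp.lmapDomain_comp ℂ ℂ (classAct R A') (classAct R A)

end QuatForms

end

noncomputable section

namespace QuatForms

/-! ### The reduced norm -/

section ReducedNorm

variable {F B : Type*} [Field F] [CharZero F] [Ring B] [Algebra F B]

/-! Let ν : cl(R) → cl(F) send [I] to the class of N(I) (`exists_normMap`), and let ℓ_A(v) be the
sum of the coefficients of v at the classes c with ν c = A (`normSum`). Distinct classes are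
orthogonal and ⟨c, c⟩ ≠ 0, so the weights 1/⟨c, c⟩ in e_A are exactly those for which ⟨e_A, v⟩ =
ℓ_A(v) (`innerForm_eisVector`). Hence S(R) is the common kernel of the ℓ_A, and the theorem follows
from four formulas, in which M = [𝔪] and n depends only on 𝔪: ℓ_A(T_𝔪 v) = n ℓ_{M⁻¹A}(v), T_𝔪 e_A =
n e_{MA}, ℓ_C([𝔞]v) = ℓ_{[𝔞]⁻²C}(v), [𝔞]e_C = e_{[𝔞]²C}. The last two hold because [𝔞] permutes
cl(R), preserves the pairing and multiplies norms by 𝔞².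

The first says that every J in t_𝔪(I) has norm 𝔪N(I) (`mem_heckeSet_iff`) and that the size n of
t_𝔪(I) is independent of I (`ncard_heckeSet_eq`): two ideals can be made equal at the primes
dividing 𝔪 by a right translation, and t_𝔪(I) sees only these primes. The second is its transpose.
By conjugation, J ∈ t_𝔪(I) implies 𝔪I ∈ t_𝔪(J), so M⁻¹T_𝔪 is adjoint to T_𝔪
(`classPair_mul_heckeOp`), and column sums of the matrix of T_𝔪 turn into weighted row sums.

Total definiteness enters through finiteness. The reduced norm is a totally positive form, so a
lattice has finitely many elements of given norm; with Dirichlet's unit theorem this makes ⟨[I],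
[I]⟩ finite and nonzero (`pairCount_self_ne_zero`). Nonzero elements are moreover invertible, and a
Euclidean argument shows that cl(R) is finite (`finite_classSet`).

Local statements are proved inside B and F, without completions: lattices are compared through
`localize`, and fractional ideals through the largest p-adic absolute value of their elements
(`IsLocalValue`). -/

theorem reducedTrace_algEquiv {C : Type*} [Ring C] [Algebra F C] (e : B ≃ₐ[F] C) (x : B) :
    reducedTrace F (e x) = reducedTrace F x := by
  rw [reducedTrace, reducedTrace, ← LinearMap.trace_conj' (LinearMap.mulLeft F x) e.toLinearEquiv]
  congr 2
  ext y
  simp [LinearEquiv.conj_apply]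

theorem reducedNorm_algEquiv {C : Type*} [Ring C] [Algebra F C] (e : B ≃ₐ[F] C) (x : B) :
    reducedNorm F (e x) = reducedNorm F x := by
  rw [reducedNorm, reducedNorm, ← map_pow, reducedTrace_algEquiv, reducedTrace_algEquiv]

/-- With the matrices of left and right multiplication explicit, the trace and determinant formulas
below become polynomial identities in the coordinates. -/
theorem toMatrix_mulLeft_quaternion (a b : F) (x : ℍ[F, a, b]) :
    LinearMap.toMatrix (QuaternionAlgebra.basisOneIJK a 0 b) (QuaternionAlgebra.basisOneIJK a 0 b)
      (LinearMap.mulLeft F x) =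
    !![x.re, a * x.imI, b * x.imJ, -(a * b * x.imK);
      x.imI, x.re, b * x.imK, -(b * x.imJ);
      x.imJ, -(a * x.imK), x.re, a * x.imI;
      x.imK, -x.imJ, x.imI, x.re] := by
  have h : ∀ j, (QuaternionAlgebra.basisOneIJK a 0 b) j =
    (QuaternionAlgebra.linearEquivTuple a 0 b).symm (Pi.single j 1) := fun j => by
      rw [QuaternionAlgebra.basisOneIJK, Module.Basis.coe_ofEquivFun]
  ext i j
  rw [LinearMap.toMatrix_apply, QuaternionAlgebra.coe_basisOneIJK_repr, h]
  fin_cases i <;> fin_cases j <;> simp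

theorem toMatrix_mulRight_quaternion (a b : F) (x : ℍ[F, a, b]) :
    LinearMap.toMatrix (QuaternionAlgebra.basisOneIJK a 0 b) (QuaternionAlgebra.basisOneIJK a 0 b)
      (LinearMap.mulRight F x) =
    !![x.re, a * x.imI, b * x.imJ, -(a * b * x.imK);
      x.imI, x.re, -(b * x.imK), b * x.imJ;
      x.imJ, a * x.imK, x.re, -(a * x.imI);
      x.imK, x.imJ, -x.imI, x.re] := by
  have h : ∀ j, (QuaternionAlgebra.basisOneIJK a 0 b) j =
    (QuaternionAlgebra.linearEquivTuple a 0 b).symm (Pi.single j 1) := fun j => by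
      rw [QuaternionAlgebra.basisOneIJK, Module.Basis.coe_ofEquivFun]
  ext i j
  rw [LinearMap.toMatrix_apply, QuaternionAlgebra.coe_basisOneIJK_repr, h]
  fin_cases i <;> fin_cases j <;> simp

theorem reducedTrace_quaternion {a b : F} (x : ℍ[F, a, b]) : reducedTrace F x = 2 * x.re := by
  rw [reducedTrace, LinearMap.trace_eq_matrix_trace F (QuaternionAlgebra.basisOneIJK a 0 b),
    toMatrix_mulLeft_quaternion]
  simp [Matrix.trace, Fin.sum_univ_succ]
  ring

theorem reducedNorm_quaternion {a b : F} (x : ℍ[F, a, b]) :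
    reducedNorm F x = x.re ^ 2 - a * x.imI ^ 2 - b * x.imJ ^ 2 + a * b * x.imK ^ 2 := by
  rw [reducedNorm, reducedTrace_quaternion, reducedTrace_quaternion, sq x]
  simp
  ring

theorem det_mulLeft_quaternion {a b : F} (x : ℍ[F, a, b]) :
    LinearMap.det (LinearMap.mulLeft F x) = reducedNorm F x ^ 2 := by
  rw [← LinearMap.det_toMatrix (QuaternionAlgebra.basisOneIJK a 0 b), toMatrix_mulLeft_quaternion,
    reducedNorm_quaternion]
  simp [Matrix.det_succ_row_zero, Fin.sum_univ_succ, Fin.succAbove]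
  ring

theorem det_mulRight_quaternion {a b : F} (x : ℍ[F, a, b]) :
    LinearMap.det (LinearMap.mulRight F x) = reducedNorm F x ^ 2 := by
  rw [← LinearMap.det_toMatrix (QuaternionAlgebra.basisOneIJK a 0 b), toMatrix_mulRight_quaternion,
    reducedNorm_quaternion]
  simp [Matrix.det_succ_row_zero, Fin.sum_univ_succ, Fin.succAbove]
  ring

namespace IsQuaternionAlgebra

variable (hB : IsQuaternionAlgebra F B)
include hB

theorem moduleFinite : Module.Finite F B := by
  obtain ⟨a, b, -, -, ⟨e⟩⟩ := hB
  exact Module.Finite.equiv e.symm.toLinearEquiv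

theorem nontrivial : Nontrivial B := by
  obtain ⟨a, b, -, -, ⟨e⟩⟩ := hB
  exact e.toEquiv.nontrivial

theorem reducedNorm_mul (x y : B) :
    reducedNorm F (x * y) = reducedNorm F x * reducedNorm F y := by
  obtain ⟨a, b, -, -, ⟨e⟩⟩ := hB
  rw [← reducedNorm_algEquiv e, ← reducedNorm_algEquiv e, ← reducedNorm_algEquiv e, map_mul]
  simp only [reducedNorm_quaternion]
  simp
  ring

theorem reducedNorm_smul (c : F) (x : B) :
    reducedNorm F (c • x) = c ^ 2 * reducedNorm F x := by
  obtain ⟨a, b, -, -, ⟨e⟩⟩ := hB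
  rw [← reducedNorm_algEquiv e, ← reducedNorm_algEquiv e, map_smul]
  simp only [reducedNorm_quaternion]
  simp
  ring

theorem reducedNorm_one : reducedNorm F (1 : B) = 1 := by
  obtain ⟨a, b, -, -, ⟨e⟩⟩ := hB
  rw [← reducedNorm_algEquiv e, map_one, reducedNorm_quaternion]
  simp

theorem reducedNorm_add_one (x : B) :
    reducedNorm F (x + 1) = reducedNorm F x + reducedTrace F x + 1 := by
  obtain ⟨a, b, -, -, ⟨e⟩⟩ := hB
  rw [← reducedNorm_algEquiv e, ← reducedNorm_algEquiv e, ← reducedTrace_algEquiv e, map_add,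
    map_one]
  simp only [reducedNorm_quaternion, reducedTrace_quaternion]
  simp
  ring

theorem mul_conj (x : B) :
    x * (algebraMap F B (reducedTrace F x) - x) = algebraMap F B (reducedNorm F x) := by
  obtain ⟨a, b, -, -, ⟨e⟩⟩ := hB
  apply e.injective
  rw [map_mul, map_sub, e.commutes, e.commutes, ← reducedNorm_algEquiv e, ← reducedTrace_algEquiv e]
  generalize e x = y
  rw [reducedNorm_quaternion, reducedTrace_quaternion]
  ext <;> simp [QuaternionAlgebra.algebraMap_eq] <;> ring

theorem conj_mul (x : B) :
    (algebraMap F B (reducedTrace F x) - x) * x = algebraMap F B (reducedNorm F x) := by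
  rw [sub_mul, Algebra.commutes, ← mul_sub, hB.mul_conj]

theorem det_mulLeft (x : B) : LinearMap.det (LinearMap.mulLeft F x) = reducedNorm F x ^ 2 := by
  obtain ⟨a, b, -, -, ⟨e⟩⟩ := hB
  rw [← reducedNorm_algEquiv e, ← det_mulLeft_quaternion,
    ← LinearMap.det_conj (LinearMap.mulLeft F x) e.toLinearEquiv]
  congr 1
  ext y <;> simp

/-- Left multiplication tests integrality on an order, while right multiplication carries one
locally principal left ideal to another; this is why determinants of both kinds are needed. -/
theorem det_mulRight (x : B) : LinearMap.det (LinearMap.mulRight F x) = reducedNorm F x ^ 2 := by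
  obtain ⟨a, b, -, -, ⟨e⟩⟩ := hB
  rw [← reducedNorm_algEquiv e, ← det_mulRight_quaternion,
    ← LinearMap.det_conj (LinearMap.mulRight F x) e.toLinearEquiv]
  congr 1
  ext y <;> simp

theorem reducedNorm_unit_ne_zero (x : Bˣ) : reducedNorm F (x : B) ≠ 0 := by
  intro h
  have := hB.reducedNorm_mul (x : B) (x⁻¹ : Bˣ)
  rw [Units.mul_inv, hB.reducedNorm_one, h, zero_mul] at this
  exact one_ne_zero this

theorem reducedNorm_inv (x : Bˣ) :
    reducedNorm F ((x⁻¹ : Bˣ) : B) = (reducedNorm F (x : B))⁻¹ := by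
  have := hB.reducedNorm_mul (x : B) (x⁻¹ : Bˣ)
  rw [Units.mul_inv, hB.reducedNorm_one] at this
  exact eq_inv_of_mul_eq_one_right this.symm

theorem isUnit_of_reducedNorm_ne_zero {x : B} (hx : reducedNorm F x ≠ 0) : IsUnit x := by
  set c := algebraMap F B (reducedTrace F x) - x
  refine ⟨⟨x, (reducedNorm F x)⁻¹ • c, ?_, ?_⟩, rfl⟩
  · rw [mul_smul_comm, hB.mul_conj, Algebra.algebraMap_eq_smul_one, smul_smul, inv_mul_cancel₀ hx,
      one_smul]
  · rw [smul_mul_assoc, hB.conj_mul, Algebra.algebraMap_eq_smul_one, smul_smul, inv_mul_cancel₀ hx,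
      one_smul]

theorem inv_eq (x : Bˣ) : ((x⁻¹ : Bˣ) : B) =
    (reducedNorm F (x : B))⁻¹ • (algebraMap F B (reducedTrace F (x : B)) - x) := by
  have h := hB.reducedNorm_unit_ne_zero x
  rw [← Units.mul_right_inj x, Units.mul_inv, mul_smul_comm, hB.mul_conj,
    Algebra.algebraMap_eq_smul_one, smul_smul, inv_mul_cancel₀ h, one_smul]

end IsQuaternionAlgebra

end ReducedNorm

/-! ### Localization of lattices -/

section Localization

variable {F B : Type*} [Field F] [NumberField F] [Ring B] [Algebra F B]

theorem le_localize (p : HeightOneSpectrum (𝓞 F)) (I : Submodule (𝓞 F) B) : I ≤ localize p I :=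
  fun _ hb => ⟨1, fun h => p.isPrime.ne_top ((Ideal.eq_top_iff_one _).2 h), by simpa using hb⟩

theorem mem_localize_of_smul_mem {p : HeightOneSpectrum (𝓞 F)} {I : Submodule (𝓞 F) B}
    {s : 𝓞 F} (hs : s ∉ p.asIdeal) {b : B} (h : s • b ∈ localize p I) : b ∈ localize p I := by
  obtain ⟨t, ht, h⟩ := h
  exact ⟨t * s, fun h' => (p.isPrime.mem_or_mem h').elim ht hs, by rwa [mul_smul]⟩

/-- Localization is idempotent, so an inclusion of localizations need only be tested on the lattice
itself. -/
theorem localize_le_localize {p : HeightOneSpectrum (𝓞 F)} {I J : Submodule (𝓞 F) B}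
    (h : I ≤ localize p J) : localize p I ≤ localize p J :=
  fun _ ⟨_, hs, hb⟩ => mem_localize_of_smul_mem hs (h hb)

theorem exists_heightOneSpectrum_le {I : Ideal (𝓞 F)} (hI : I ≠ ⊤) :
    ∃ p : HeightOneSpectrum (𝓞 F), I ≤ p.asIdeal := by
  obtain ⟨M, hM, hle⟩ := Ideal.exists_le_maximal I hI
  exact ⟨⟨M, hM.isPrime, Ring.ne_bot_of_isMaximal_of_not_isField hM
    (RingOfIntegers.not_isField F)⟩, hle⟩

/-- The scalars s with s b ∈ I form an ideal; by hypothesis no prime contains it, so it contains 1.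
-/
theorem mem_of_forall_mem_localize {I : Submodule (𝓞 F) B} {b : B}
    (h : ∀ p : HeightOneSpectrum (𝓞 F), b ∈ localize p I) : b ∈ I := by
  by_contra hb
  obtain ⟨p, hp⟩ := exists_heightOneSpectrum_le
    (I := I.comap (LinearMap.toSpanSingleton (𝓞 F) B b)) fun htop => hb (by
      simpa using ((Ideal.eq_top_iff_one _).1 htop : (1 : 𝓞 F) ∈ _))
  obtain ⟨s, hs, hsb⟩ := h p
  exact hs (hp (by simpa using hsb))

theorem le_of_localize_le {I J : Submodule (𝓞 F) B}
    (h : ∀ p : HeightOneSpectrum (𝓞 F), localize p I ≤ localize p J) : I ≤ J :=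
  fun _ hb => mem_of_forall_mem_localize fun p => h p (le_localize p I hb)

/-- Common denominators: the product of denominators of finitely many generators works for the whole
lattice. It is used both with the complement of a prime and with all nonzero scalars. -/
theorem exists_mem_submonoid_smul_mem (S : Submonoid (𝓞 F)) {I J : Submodule (𝓞 F) B} (hI : I.FG)
    (h : ∀ y ∈ I, ∃ s ∈ S, s • y ∈ J) : ∃ s ∈ S, ∀ y ∈ I, s • y ∈ J := by
  obtain ⟨T, rfl⟩ := hI
  have h' : ∀ y ∈ T, ∃ s ∈ S, s • y ∈ J := fun y hy => h y (Submodule.subset_span hy)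
  choose! f hf hfJ using h'
  refine ⟨∏ y ∈ T, f y, prod_mem hf, fun y hy => ?_⟩
  induction hy using Submodule.span_induction with
  | mem y hy =>
    classical
    rw [← Finset.prod_erase_mul T f hy, mul_smul]
    exact J.smul_mem _ (hfJ y hy)
  | zero => simp
  | add y z _ _ hy hz => rw [smul_add]; exact J.add_mem hy hz
  | smul c y _ hy => rw [smul_comm]; exact J.smul_mem _ hy

theorem exists_smul_mem_of_le_localize {p : HeightOneSpectrum (𝓞 F)} {I J : Submodule (𝓞 F) B}
    (hI : I.FG) (h : I ≤ localize p J) : ∃ s ∉ p.asIdeal, ∀ y ∈ I, s • y ∈ J :=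
  exists_mem_submonoid_smul_mem p.asIdeal.primeCompl hI fun _ hy => h hy

theorem exists_nonZeroDivisor_smul_mem {J : Submodule (𝓞 F) B}
    (hJ : Submodule.span F (J : Set B) = ⊤) (b : B) : ∃ s ∈ (𝓞 F)⁰, s • b ∈ J := by
  have hb : b ∈ Submodule.span F (J : Set B) := hJ ▸ Submodule.mem_top
  induction hb using Submodule.span_induction with
  | mem y hy => exact ⟨1, one_mem _, by simpa using hy⟩
  | zero => exact ⟨1, one_mem _, by simp⟩
  | add y z _ _ hy hz =>
    obtain ⟨s, hs, hy⟩ := hy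
    obtain ⟨t, ht, hz⟩ := hz
    refine ⟨s * t, mul_mem hs ht, ?_⟩
    rw [smul_add]
    refine J.add_mem ?_ ?_
    · rw [mul_comm, mul_smul]; exact J.smul_mem _ hy
    · rw [mul_smul]; exact J.smul_mem _ hz
  | smul c y _ hy =>
    obtain ⟨s, hs, hy⟩ := hy
    obtain ⟨n, d, hd, rfl⟩ := IsFractionRing.div_surjective (A := 𝓞 F) c
    refine ⟨d * s, mul_mem hd hs, ?_⟩
    have hd0 : algebraMap (𝓞 F) F d ≠ 0 := by
      simpa using nonZeroDivisors.ne_zero hd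
    have : (d * s) • (algebraMap (𝓞 F) F n / algebraMap (𝓞 F) F d) • y = n • s • y := by
      rw [← algebraMap_smul F, ← algebraMap_smul F n, ← algebraMap_smul F s, smul_smul, smul_smul,
        map_mul]
      congr 1
      field_simp
    rw [this]
    exact J.smul_mem _ hy

theorem exists_nonZeroDivisor_smul_mem_of_fg {I J : Submodule (𝓞 F) B} (hI : I.FG)
    (hJ : Submodule.span F (J : Set B) = ⊤) : ∃ s ∈ (𝓞 F)⁰, ∀ y ∈ I, s • y ∈ J :=
  exists_mem_submonoid_smul_mem _ hI fun y _ => exists_nonZeroDivisor_smul_mem hJ y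

theorem smul_mem_localize {p : HeightOneSpectrum (𝓞 F)} {I : Submodule (𝓞 F) B} {c : F}
    (hc : p.valuation F c ≤ 1) {b : B} (hb : b ∈ localize p I) : c • b ∈ localize p I := by
  obtain ⟨n, d, hnd⟩ := p.exists_primeCompl_mul_eq_of_integer c hc
  refine mem_localize_of_smul_mem d.2 ?_
  have : (d : 𝓞 F) • c • b = n • b := by
    rw [← algebraMap_smul F, ← algebraMap_smul F n, smul_smul, mul_comm, hnd]
  exact this ▸ Submodule.smul_mem _ _ hb

theorem mul_mem_localize {p : HeightOneSpectrum (𝓞 F)} {I J K : Submodule (𝓞 F) B}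
    (h : I * J ≤ K) {x y : B} (hx : x ∈ localize p I) (hy : y ∈ localize p J) :
    x * y ∈ localize p K := by
  obtain ⟨s, hs, hx⟩ := hx
  obtain ⟨t, ht, hy⟩ := hy
  refine ⟨s * t, fun h' => (p.isPrime.mem_or_mem h').elim hs ht, h ?_⟩
  have : (s * t) • (x * y) = (s • x) * (t • y) := by rw [smul_mul_smul_comm]
  exact this ▸ Submodule.mul_mem_mul hx hy

theorem mem_rtrans_unit {I : Submodule (𝓞 F) B} (x : Bˣ) {b : B} :
    b ∈ rtrans I (x : B) ↔ b * ((x⁻¹ : Bˣ) : B) ∈ I := by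
  rw [mem_rtrans]
  constructor
  · rintro ⟨y, hy, rfl⟩
    simpa using hy
  · exact fun h => ⟨_, h, by simp⟩

theorem exists_algebraMap_eq_of_valuation_le_one {x : F}
    (h : ∀ p : HeightOneSpectrum (𝓞 F), p.valuation F x ≤ 1) :
    ∃ s : 𝓞 F, algebraMap (𝓞 F) F s = x :=
  HeightOneSpectrum.mem_integers_of_valuation_le_one F x h

end Localization

/-! ### Local values of submodules of `F` -/

section LocalValue

variable {F : Type*} [Field F] [NumberField F]

/-- `g` is the largest `p`-adic absolute value of an element of `A`. -/
def IsLocalValue (p : HeightOneSpectrum (𝓞 F)) (A : Submodule (𝓞 F) F)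
    (g : WithZero (Multiplicative ℤ)) : Prop :=
  IsGreatest (p.valuation F '' (A : Set F)) g

namespace IsLocalValue

variable {p : HeightOneSpectrum (𝓞 F)} {A A' : Submodule (𝓞 F) F}
  {g g' : WithZero (Multiplicative ℤ)}

theorem unique (h : IsLocalValue p A g) (h' : IsLocalValue p A g') : g = g' :=
  IsGreatest.unique h h'

/-- An element of largest absolute value generates the localization: the quotient of x by it has
valuation at most 1. Hence local values determine a submodule of F, as `eq_of_isLocalValue`
exploits. -/
theorem mem_localize (h : IsLocalValue p A g) {x : F} (hx : p.valuation F x ≤ g) :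
    x ∈ localize p A := by
  obtain ⟨⟨y, hy, rfl⟩, -⟩ := h
  rcases eq_or_ne y 0 with rfl | hy0
  · rw [map_zero, le_zero_iff, map_eq_zero] at hx
    exact hx ▸ zero_mem _
  · have : x = (x / y) • y := by rw [smul_eq_mul, div_mul_cancel₀ x hy0]
    rw [this]
    refine smul_mem_localize ?_ (le_localize p A hy)
    rw [map_div₀]
    exact div_le_one_of_le₀ hx zero_le

theorem span {S : Set F} (h : IsGreatest (p.valuation F '' S) g) :
    IsLocalValue p (Submodule.span (𝓞 F) S) g := by
  obtain ⟨⟨y, hy, hyg⟩, hle⟩ := h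
  refine ⟨⟨y, Submodule.subset_span hy, hyg⟩, ?_⟩
  rintro _ ⟨x, hx, rfl⟩
  induction hx using Submodule.span_induction with
  | mem x hx => exact hle ⟨x, hx, rfl⟩
  | zero => simp
  | add x z _ _ hx hz => exact (Valuation.map_add _ _ _).trans (max_le hx hz)
  | smul c x _ hx =>
    rw [Algebra.smul_def, map_mul]
    exact (mul_le_mul' (p.valuation_le_one c) hx).trans (one_mul _).le

theorem mul (h : IsLocalValue p A g) (h' : IsLocalValue p A' g') :
    IsLocalValue p (A * A') (g * g') := by
  obtain ⟨⟨y, hy, rfl⟩, hle⟩ := h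
  obtain ⟨⟨y', hy', rfl⟩, hle'⟩ := h'
  refine ⟨⟨y * y', Submodule.mul_mem_mul hy hy', map_mul _ _ _⟩, ?_⟩
  rintro _ ⟨x, hx, rfl⟩
  refine Submodule.mul_induction_on hx (fun m hm n hn => ?_) fun x z hx hz =>
    (Valuation.map_add _ _ _).trans (max_le hx hz)
  rw [map_mul]
  exact mul_le_mul' (hle ⟨m, hm, rfl⟩) (hle' ⟨n, hn, rfl⟩)

theorem span_singleton (p : HeightOneSpectrum (𝓞 F)) (x : F) :
    IsLocalValue p (Submodule.span (𝓞 F) {x}) (p.valuation F x) :=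
  span (by simp)

end IsLocalValue

theorem le_of_isLocalValue {A A' : Submodule (𝓞 F) F}
    (h : ∀ p : HeightOneSpectrum (𝓞 F), ∃ g g', IsLocalValue p A g ∧ IsLocalValue p A' g' ∧
      g ≤ g') : A ≤ A' := by
  intro x hx
  refine mem_of_forall_mem_localize fun p => ?_
  obtain ⟨g, g', hA, hA', hle⟩ := h p
  exact hA'.mem_localize ((hA.2 ⟨x, hx, rfl⟩).trans hle)

theorem eq_of_isLocalValue {A A' : Submodule (𝓞 F) F}
    (h : ∀ p : HeightOneSpectrum (𝓞 F), ∃ g, IsLocalValue p A g ∧ IsLocalValue p A' g) :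
    A = A' :=
  le_antisymm
    (le_of_isLocalValue fun p => let ⟨g, hg⟩ := h p; ⟨g, g, hg.1, hg.2, le_rfl⟩)
    (le_of_isLocalValue fun p => let ⟨g, hg⟩ := h p; ⟨g, g, hg.2, hg.1, le_rfl⟩)

theorem exists_isLocalValue_fractionalIdeal (p : HeightOneSpectrum (𝓞 F))
    (𝔞 : (FractionalIdeal (𝓞 F)⁰ F)ˣ) :
    ∃ ξ : Fˣ, IsLocalValue p ((𝔞 : FractionalIdeal (𝓞 F)⁰ F) : Submodule (𝓞 F) F)
      (p.valuation F (ξ : F)) := by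
  obtain ⟨ξ, s, hs, hle, h⟩ := exists_local_generator p 𝔞
  refine ⟨ξ, ⟨ξ, hle (Submodule.mem_span_singleton_self _), rfl⟩, ?_⟩
  rintro _ ⟨α, hα, rfl⟩
  have := (IsLocalValue.span_singleton p (ξ : F)).2 ⟨_, h α hα, rfl⟩
  rwa [Algebra.smul_def, map_mul, p.valuation_eq_one_iff_notMem.2 hs, one_mul] at this

/-- The image in `F` of a nonzero ideal of `𝓞 F` is an invertible fractional ideal. -/
theorem exists_fractionalIdeal_eq_map {𝔪 : Ideal (𝓞 F)} (h : 𝔪 ≠ ⊥) :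
    ∃ 𝔞 : (FractionalIdeal (𝓞 F)⁰ F)ˣ, ((𝔞 : FractionalIdeal (𝓞 F)⁰ F) : Submodule (𝓞 F) F) =
      Submodule.map (Algebra.linearMap (𝓞 F) F) 𝔪 :=
  ⟨FractionalIdeal.mk0 F ⟨𝔪, mem_nonZeroDivisors_of_ne_zero h⟩, by
    rw [FractionalIdeal.coe_mk0, FractionalIdeal.coe_coeIdeal]; rfl⟩

theorem exists_fractionalIdeal_eq {A : Submodule (𝓞 F) F} {x : F} (hx : x ∈ A) (hx0 : x ≠ 0)
    {d : 𝓞 F} (hd : d ≠ 0) (h : ∀ y ∈ A, ∃ s : 𝓞 F, algebraMap (𝓞 F) F s = d • y) :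
    ∃ 𝔞 : (FractionalIdeal (𝓞 F)⁰ F)ˣ,
      A = ((𝔞 : FractionalIdeal (𝓞 F)⁰ F) : Submodule (𝓞 F) F) := by
  let I : FractionalIdeal (𝓞 F)⁰ F :=
    ⟨A, d, mem_nonZeroDivisors_of_ne_zero hd, fun y hy => h y hy⟩
  have hI : I ≠ 0 := by
    rintro h0
    have : x ∈ I := hx
    rw [h0, FractionalIdeal.mem_zero_iff] at this
    exact hx0 this
  exact ⟨Units.mk0 I hI, rfl⟩

end LocalValue

/-! ### Determinants of endomorphisms of lattices -/

section Determinant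

variable {O K V : Type*} [CommRing O] [IsDomain O] [IsNoetherianRing O] [Field K] [Algebra O K]
  [IsFractionRing O K] [AddCommGroup V] [Module K V] [Module O V] [IsScalarTower O K V]
  [Module.Finite K V]

/-- The determinant of an endomorphism preserving a lattice is integral. -/
theorem isIntegral_det_of_isLattice {I : Submodule O V} (hI : Submodule.IsLattice K I)
    {δ : V →ₗ[K] V} (hδ : ∀ y ∈ I, δ y ∈ I) : IsIntegral O (LinearMap.det δ) := by
  classical
  let b := Module.Basis.ofSpan hI.span_eq_top.ge
  have hb : ∀ i, b i ∈ I := fun i => Module.Basis.ofSpan_subset hI.span_eq_top.ge ⟨i, rfl⟩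
  have : Fintype _ := FiniteDimensional.fintypeBasisIndex b
  have hfg : (⨆ i, I.map ((b.coord i).restrictScalars O)).FG :=
    Submodule.fg_iSup _ fun i => hI.fg.map _
  obtain ⟨d, hd, hdI⟩ := FractionalIdeal.isFractional_of_fg (S := O⁰) hfg
  have hint : ∀ i, ∀ y ∈ I, ∃ s : O, algebraMap O K s = d • b.repr y i := fun i y hy =>
    hdI _ (Submodule.mem_iSup_of_mem i ⟨y, hy, rfl⟩)
  -- Every power of δ preserves I, so the matrices of all δⁿ have entries with the same denominator
  -- d. Thus d ^ rank is a common denominator for all powers of det δ, which is therefore almost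
  -- integral, hence integral over a Noetherian ring.
  refine IsAlmostIntegral.isIntegral ⟨d ^ Module.finrank K V, pow_mem hd _, fun n => ?_⟩
  have hn : ∀ y ∈ I, (δ ^ n) y ∈ I := by
    induction n with
    | zero => simp
    | succ n ih => intro y hy; rw [pow_succ, Module.End.mul_apply]; exact ih _ (hδ y hy)
  choose f hf using fun i j => hint i _ (hn _ (hb j))
  refine ⟨(Matrix.of f).det, ?_⟩
  rw [← map_pow, ← LinearMap.det_toMatrix b, RingHom.map_det,
    Module.finrank_eq_card_basis b, Algebra.smul_def, map_pow, ← Matrix.det_smul]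
  congr 1
  ext i j
  simp [hf, LinearMap.toMatrix_apply, Algebra.smul_def]

end Determinant

/-! ### Norm and index ideals of locally principal ideals -/

section NormIdeal

variable {F B : Type*} [Field F] [NumberField F] [Ring B] [Algebra F B]

/-- Some s outside p makes s δ preserve I itself. Its determinant is integral, and differs from that
of δ by a power of s, a p-adic unit. -/
theorem valuation_det_le_one [Module.Finite F B] {p : HeightOneSpectrum (𝓞 F)}
    {I : Submodule (𝓞 F) B} (hI : Submodule.IsLattice F I) {δ : B →ₗ[F] B}
    (hδ : ∀ y ∈ I, δ y ∈ localize p I) : p.valuation F (LinearMap.det δ) ≤ 1 := by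
  obtain ⟨s, hs, h⟩ := exists_smul_mem_of_le_localize (I := I.map (δ.restrictScalars (𝓞 F)))
    (J := I) (p := p) (hI.fg.map _) (by rintro _ ⟨y, hy, rfl⟩; exact hδ y hy)
  have hint := isIntegral_det_of_isLattice hI (δ := algebraMap (𝓞 F) F s • δ) fun y hy => by
    rw [LinearMap.smul_apply, algebraMap_smul]
    exact h _ ⟨y, hy, rfl⟩
  obtain ⟨t, ht⟩ := IsIntegrallyClosed.isIntegral_iff.1 hint
  have := p.valuation_le_one (K := F) t
  change p.valuation F (algebraMap (𝓞 F) F t) ≤ 1 at this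
  rwa [ht, LinearMap.det_smul, map_mul, map_pow, p.valuation_eq_one_iff_notMem.2 hs, one_pow,
    one_mul] at this

namespace IsQuaternionAlgebra

variable {R : Subalgebra (𝓞 F) B} {p : HeightOneSpectrum (𝓞 F)}
variable (hB : IsQuaternionAlgebra F B) (hR : IsOrder R)
include hB hR

/-- Left multiplication by x maps R into its localization, and its determinant is the square of the
reduced norm. -/
theorem valuation_reducedNorm_le_one {x : B} (hx : x ∈ localize p (Subalgebra.toSubmodule R)) :
    p.valuation F (reducedNorm F x) ≤ 1 := by
  have := hB.moduleFinite
  have h := valuation_det_le_one (p := p) (δ := LinearMap.mulLeft F x) hR fun y hy =>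
    mul_mem_localize (K := Subalgebra.toSubmodule R) (Submodule.mul_le.2 fun _ ha _ hb => R.mul_mem ha hb) hx
      (le_localize p _ hy)
  rw [hB.det_mulLeft, map_pow] at h
  exact (pow_le_one_iff_of_nonneg zero_le two_ne_zero).1 h

/-- The trace is obtained from the norms of x and x + 1, both integral at p, so no division by 2 is
involved. -/
theorem valuation_reducedTrace_le_one {x : B} (hx : x ∈ localize p (Subalgebra.toSubmodule R)) :
    p.valuation F (reducedTrace F x) ≤ 1 := by
  have h1 := hB.valuation_reducedNorm_le_one hR (add_mem hx (le_localize p _ R.one_mem))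
  have h2 := hB.valuation_reducedNorm_le_one hR hx
  rw [hB.reducedNorm_add_one] at h1
  have : reducedTrace F x = (reducedNorm F x + reducedTrace F x + 1) - (reducedNorm F x + 1) := by
    ring
  rw [this]
  refine (Valuation.map_sub _ _ _).trans (max_le h1 ?_)
  exact (Valuation.map_add _ _ _).trans (max_le h2 (map_one _).le)

theorem conj_mem_localize {x : B} (hx : x ∈ localize p (Subalgebra.toSubmodule R)) :
    algebraMap F B (reducedTrace F x) - x ∈ localize p (Subalgebra.toSubmodule R) := by
  refine sub_mem ?_ hx
  rw [Algebra.algebraMap_eq_smul_one]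
  exact smul_mem_localize (hB.valuation_reducedTrace_le_one hR hx) (le_localize p _ R.one_mem)

/-- The inverse is the conjugate divided by the norm, and the conjugate trd(x) - x stays in the
local order. This is the source of the duality between J ⊆ I and 𝔪I ⊆ J. -/
theorem smul_inv_mem_localize {x : Bˣ} (hx : (x : B) ∈ localize p (Subalgebra.toSubmodule R))
    {c : F} (hc : p.valuation F c ≤ p.valuation F (reducedNorm F (x : B))) :
    c • ((x⁻¹ : Bˣ) : B) ∈ localize p (Subalgebra.toSubmodule R) := by
  rw [hB.inv_eq, smul_smul]
  refine smul_mem_localize ?_ (hB.conj_mem_localize hR hx)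
  rw [map_mul, map_inv₀]
  exact mul_inv_le_one_of_le₀ hc zero_le

/-- The norm of a lattice that is principal at `p`. -/
theorem isLocalValue_normIdeal {I : Submodule (𝓞 F) B} {x : Bˣ}
    (hx : localize p I = rtrans (localize p (Subalgebra.toSubmodule R)) x) :
    IsLocalValue p (normIdeal I) (p.valuation F (reducedNorm F (x : B))) := by
  refine IsLocalValue.span ⟨?_, ?_⟩
  · have : (x : B) ∈ localize p I := by
      rw [hx, mem_rtrans_unit, Units.mul_inv]; exact le_localize p _ R.one_mem
    obtain ⟨s, hs, hsx⟩ := this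
    refine ⟨_, ⟨s • (x : B), hsx, rfl⟩, ?_⟩
    rw [← algebraMap_smul F, hB.reducedNorm_smul, map_mul, map_pow,
      p.valuation_eq_one_iff_notMem.2 hs, one_pow, one_mul]
  · rintro _ ⟨_, ⟨y, hy, rfl⟩, rfl⟩
    have hy' := le_localize p I hy
    rw [hx, mem_rtrans] at hy'
    obtain ⟨z, hz, rfl⟩ := hy'
    rw [hB.reducedNorm_mul, map_mul]
    exact mul_le_of_le_one_left' (hB.valuation_reducedNorm_le_one hR hz)

/-- The index of lattices that are principal at `p`. -/
theorem isLocalValue_indexIdeal {I J : Submodule (𝓞 F) B} (hI : Submodule.IsLattice F I)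
    {x y : Bˣ} (hx : localize p I = rtrans (localize p (Subalgebra.toSubmodule R)) x)
    (hy : localize p J = rtrans (localize p (Subalgebra.toSubmodule R)) y) :
    IsLocalValue p (indexIdeal I J)
      ((p.valuation F (reducedNorm F (y : B)) / p.valuation F (reducedNorm F (x : B))) ^ 2) := by
  have := hB.moduleFinite
  have hx0 := (Valuation.ne_zero_iff (p.valuation F)).2 (hB.reducedNorm_unit_ne_zero x)
  have hy0 := (Valuation.ne_zero_iff (p.valuation F)).2 (hB.reducedNorm_unit_ne_zero y)
  refine IsLocalValue.span ⟨?_, ?_⟩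
  · obtain ⟨s, hs, h⟩ := exists_smul_mem_of_le_localize (p := p) (J := J)
      (I := I.map ((LinearMap.mulRight F ((x⁻¹ * y : Bˣ) : B)).restrictScalars (𝓞 F)))
      (hI.fg.map _) (by
        rintro _ ⟨z, hz, rfl⟩
        have := le_localize p I hz
        rw [hx, mem_rtrans_unit] at this
        rw [hy, mem_rtrans_unit]
        simpa [← mul_assoc] using this)
    refine ⟨_, ⟨algebraMap (𝓞 F) F s • LinearMap.mulRight F ((x⁻¹ * y : Bˣ) : B), fun z hz => ?_,
      rfl⟩, ?_⟩
    · rw [LinearMap.smul_apply, algebraMap_smul]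
      exact h _ ⟨z, hz, rfl⟩
    · rw [LinearMap.det_smul, map_mul, map_pow, p.valuation_eq_one_iff_notMem.2 hs, one_pow,
        one_mul, hB.det_mulRight, Units.val_mul, hB.reducedNorm_mul, hB.reducedNorm_inv, map_pow,
        map_mul, map_inv₀, mul_comm, div_eq_mul_inv]
  -- Following δ : I → J by right multiplication with y⁻¹x, which takes the localization of J onto
  -- that of I, gives a map of I into its localization, with determinant integral at p.
  · rintro _ ⟨_, ⟨δ, hδ, rfl⟩, rfl⟩
    have h := valuation_det_le_one (p := p) hI
      (δ := LinearMap.mulRight F ((y⁻¹ * x : Bˣ) : B) ∘ₗ δ) fun z hz => by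
        have := le_localize p J (hδ z hz)
        rw [hy, mem_rtrans_unit] at this
        rw [hx, mem_rtrans_unit]
        simpa [mul_assoc] using this
    rw [LinearMap.det_comp, hB.det_mulRight, Units.val_mul, hB.reducedNorm_mul, hB.reducedNorm_inv,
      map_mul, map_pow, map_mul, map_inv₀] at h
    refine le_of_eq_of_le ?_ (mul_le_of_le_one_right' h)
    field_simp

end IsQuaternionAlgebra

variable {R : Subalgebra (𝓞 F) B}

theorem InvIdeal.exists_isLocalValue_normIdeal (hB : IsQuaternionAlgebra F B) (hR : IsOrder R)
    (I : InvIdeal R) (p : HeightOneSpectrum (𝓞 F)) :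
    ∃ g, g ≠ 0 ∧ IsLocalValue p (normIdeal I.carrier) g := by
  obtain ⟨x, hx⟩ := I.locallyPrincipal p
  exact ⟨_, (Valuation.ne_zero_iff _).2 (hB.reducedNorm_unit_ne_zero x),
    hB.isLocalValue_normIdeal hR hx⟩

theorem exists_isLocalValue_ideal {𝔪 : Ideal (𝓞 F)} (h𝔪 : 𝔪 ≠ ⊥) (p : HeightOneSpectrum (𝓞 F)) :
    ∃ ξ : Fˣ, IsLocalValue p (Submodule.map (Algebra.linearMap (𝓞 F) F) 𝔪)
      (p.valuation F (ξ : F)) := by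
  obtain ⟨𝔞, h⟩ := exists_fractionalIdeal_eq_map (F := F) h𝔪
  exact h ▸ exists_isLocalValue_fractionalIdeal p 𝔞

/-- For locally principal ideals the condition `[I : J] = 𝔪²` says that `N(J) = 𝔪 N(I)`. -/
theorem mem_heckeSet_iff (hB : IsQuaternionAlgebra F B) (hR : IsOrder R) {𝔪 : Ideal (𝓞 F)}
    (h𝔪 : 𝔪 ≠ ⊥) {I J : InvIdeal R} :
    J ∈ heckeSet 𝔪 I ↔ J.carrier ≤ I.carrier ∧ normIdeal J.carrier =
      Submodule.map (Algebra.linearMap (𝓞 F) F) 𝔪 * normIdeal I.carrier := by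
  refine and_congr_right fun _ => ?_
  have hsq : Submodule.map (Algebra.linearMap (𝓞 F) F) (𝔪 ^ 2) =
      Submodule.map (Algebra.linearMap (𝓞 F) F) 𝔪 *
        Submodule.map (Algebra.linearMap (𝓞 F) F) 𝔪 := by
    rw [sq]
    exact Submodule.map_mul 𝔪 𝔪 (Algebra.ofId (𝓞 F) F)
  rw [hsq]
  have key : ∀ p : HeightOneSpectrum (𝓞 F), ∃ i j m : WithZero (Multiplicative ℤ), i ≠ 0 ∧
      IsLocalValue p (normIdeal I.carrier) i ∧ IsLocalValue p (normIdeal J.carrier) j ∧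
      IsLocalValue p (Submodule.map (Algebra.linearMap (𝓞 F) F) 𝔪) m ∧
      IsLocalValue p (indexIdeal I.carrier J.carrier) ((j / i) ^ 2) := fun p => by
    obtain ⟨x, hx⟩ := I.locallyPrincipal p
    obtain ⟨y, hy⟩ := J.locallyPrincipal p
    obtain ⟨ξ, hξ⟩ := exists_isLocalValue_ideal h𝔪 p
    exact ⟨_, _, _, (Valuation.ne_zero_iff _).2 (hB.reducedNorm_unit_ne_zero x),
      hB.isLocalValue_normIdeal hR hx, hB.isLocalValue_normIdeal hR hy, hξ,
      hB.isLocalValue_indexIdeal hR I.isLattice hx hy⟩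
  constructor <;> intro h <;> refine eq_of_isLocalValue fun p => ?_ <;>
    obtain ⟨i, j, m, hi0, hi, hj, hm, hij⟩ := key p
  · refine ⟨j, hj, ?_⟩
    have := hij.unique (h ▸ hm.mul hm)
    rw [← sq] at this
    -- Locally the index is the square of N(J)/N(I), and squaring is injective on values.
    have := (pow_left_inj₀ zero_le zero_le two_ne_zero).1 this
    rw [div_eq_iff hi0] at this
    exact this ▸ hm.mul hi
  · refine ⟨_, hij, ?_⟩
    have := hj.unique (h ▸ hm.mul hi)
    rw [← div_eq_iff hi0] at this
    rw [this, sq]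
    exact hm.mul hm

/-- Unlike `exists_localize_idealMul`, this allows any ξ of the correct valuation, so one choice of
ξ can serve the ideal and its norm at once. -/
theorem localize_idealMul {p : HeightOneSpectrum (𝓞 F)} {𝔞 : Submodule (𝓞 F) F} {ξ : Fˣ}
    (h : IsLocalValue p 𝔞 (p.valuation F (ξ : F))) (I : Submodule (𝓞 F) B) :
    localize p (idealMul 𝔞 I) = rtrans (localize p I) (scalarUnit (B := B) ξ : B) := by
  have hunit : ∀ (b : B) (η : Fˣ), b * (scalarUnit (B := B) η : B) = (η : F) • b := fun b η => by
    rw [Algebra.smul_def, Algebra.commutes]; rfl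
  obtain ⟨⟨η, hη, hηξ⟩, hle⟩ := h
  refine le_antisymm ?_ fun b hb => ?_
  · rw [← localize_rtrans]
    refine localize_le_localize ?_
    refine Submodule.mul_le.2 ?_
    rintro _ ⟨α, hα, rfl⟩ y hy
    rw [localize_rtrans, mem_rtrans_unit, ← map_inv, hunit]
    change _ • (algebraMap F B α * y) ∈ _
    rw [← Algebra.smul_def, smul_smul]
    refine smul_mem_localize ?_ (le_localize p I hy)
    rw [map_mul, Units.val_inv_eq_inv_val, map_inv₀]
    exact inv_mul_le_one_of_le₀ (hle ⟨α, hα, rfl⟩) zero_le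
  · rw [mem_rtrans] at hb
    obtain ⟨y, ⟨s, hs, hy⟩, rfl⟩ := hb
    refine mem_localize_of_smul_mem hs ?_
    have hη0 : η ≠ 0 := by
      rintro rfl
      rw [map_zero] at hηξ
      exact (Valuation.ne_zero_iff _).2 ξ.ne_zero hηξ.symm
    have : s • (y * (scalarUnit (B := B) ξ : B)) = ((ξ : F) / η) • (algebraMap F B η * (s • y)) := by
      rw [hunit, smul_comm, ← Algebra.smul_def, smul_smul, div_mul_cancel₀ _ hη0]
    rw [this]
    refine smul_mem_localize (by rw [map_div₀, hηξ]; exact div_self_le_one _)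
      (le_localize p _ (Submodule.mul_mem_mul ⟨η, hη, rfl⟩ hy))

theorem InvIdeal.normIdeal_smulIdeal (hB : IsQuaternionAlgebra F B) (hR : IsOrder R)
    (𝔞 : (FractionalIdeal (𝓞 F)⁰ F)ˣ) (I : InvIdeal R) :
    normIdeal (I.smulIdeal 𝔞).carrier =
      ((𝔞 : FractionalIdeal (𝓞 F)⁰ F) : Submodule (𝓞 F) F) *
      ((𝔞 : FractionalIdeal (𝓞 F)⁰ F) : Submodule (𝓞 F) F) * normIdeal I.carrier := by
  refine eq_of_isLocalValue fun p => ?_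
  obtain ⟨x, hx⟩ := I.locallyPrincipal p
  obtain ⟨ξ, hξ⟩ := exists_isLocalValue_fractionalIdeal p 𝔞
  have h := localize_idealMul hξ I.carrier
  rw [hx, rtrans_rtrans, ← Units.val_mul] at h
  refine ⟨_, hB.isLocalValue_normIdeal hR h, ?_⟩
  have h2 := (hξ.mul hξ).mul (hB.isLocalValue_normIdeal hR hx)
  convert h2 using 1
  have : (scalarUnit (B := B) ξ : B) = (ξ : F) • 1 := Algebra.algebraMap_eq_smul_one _
  rw [Units.val_mul, hB.reducedNorm_mul, this, hB.reducedNorm_smul, hB.reducedNorm_one]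
  simp only [map_mul, map_pow, mul_one]
  rw [mul_comm, sq]

theorem InvIdeal.normIdeal_rmul (hB : IsQuaternionAlgebra F B) (hR : IsOrder R)
    (I : InvIdeal R) (x : Bˣ) :
    normIdeal (I.rmul x).carrier =
      Submodule.span (𝓞 F) {reducedNorm F (x : B)} * normIdeal I.carrier := by
  refine eq_of_isLocalValue fun p => ?_
  obtain ⟨y, hy⟩ := I.locallyPrincipal p
  have h : localize p (I.rmul x).carrier =
      rtrans (localize p (Subalgebra.toSubmodule R)) ((y * x : Bˣ) : B) := by
    rw [Units.val_mul, ← rtrans_rtrans, ← hy]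
    exact localize_rtrans p I.carrier x
  refine ⟨_, hB.isLocalValue_normIdeal hR h, ?_⟩
  convert (IsLocalValue.span_singleton p (reducedNorm F (x : B))).mul
    (hB.isLocalValue_normIdeal hR hy) using 1
  rw [Units.val_mul, hB.reducedNorm_mul, map_mul, mul_comm]

/-- If s ∈ I and d I ⊆ R for nonzero s, d in 𝓞 F, then N(I) contains s² and has denominator d². -/
theorem InvIdeal.exists_normIdeal_eq (hB : IsQuaternionAlgebra F B) (hR : IsOrder R)
    (I : InvIdeal R) : ∃ 𝔞 : (FractionalIdeal (𝓞 F)⁰ F)ˣ,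
      normIdeal I.carrier = ((𝔞 : FractionalIdeal (𝓞 F)⁰ F) : Submodule (𝓞 F) F) := by
  obtain ⟨d, hd, hdI⟩ := exists_nonZeroDivisor_smul_mem_of_fg I.isLattice.fg hR.span_eq_top
  have hd0 := nonZeroDivisors.ne_zero hd
  obtain ⟨s, hs, hsI⟩ := exists_nonZeroDivisor_smul_mem I.isLattice.span_eq_top (1 : B)
  have hs0 := nonZeroDivisors.ne_zero hs
  refine exists_fractionalIdeal_eq (x := algebraMap (𝓞 F) F s ^ 2)
    (Submodule.subset_span ⟨_, hsI, ?_⟩) ?_ (pow_ne_zero 2 hd0) fun y hy => ?_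
  · rw [← algebraMap_smul F, hB.reducedNorm_smul, hB.reducedNorm_one, mul_one]
  · simpa using hs0
  · have : IsIntegral (𝓞 F) (d ^ 2 • y) := by
      induction hy using Submodule.span_induction with
      | mem y hy =>
        obtain ⟨b, hb, rfl⟩ := hy
        refine IsIntegrallyClosed.isIntegral_iff.2 (exists_algebraMap_eq_of_valuation_le_one
          fun p => ?_)
        rw [Algebra.smul_def, map_pow, ← hB.reducedNorm_smul, algebraMap_smul]
        exact hB.valuation_reducedNorm_le_one hR (le_localize p _ (hdI b hb))
      | zero => simp [isIntegral_zero]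
      | add y z _ _ hy hz => rw [smul_add]; exact hy.add hz
      | smul c y _ hy => rw [smul_comm]; exact hy.smul c
    exact IsIntegrallyClosed.isIntegral_iff.1 this

end NormIdeal

/-! ### The sets `t_𝔪(I)` -/

section Hecke

variable {F B : Type*} [Field F] [NumberField F] [Ring B] [Algebra F B]
variable {R : Subalgebra (𝓞 F) B}

namespace InvIdeal

theorem smulIdeal_rmul (𝔞 : (FractionalIdeal (𝓞 F)⁰ F)ˣ) (I : InvIdeal R) (x : Bˣ) :
    (I.rmul x).smulIdeal 𝔞 = (I.smulIdeal 𝔞).rmul x :=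
  InvIdeal.ext (idealMul_rtrans _ I.carrier x)

theorem smulIdeal_mul (𝔞 𝔟 : (FractionalIdeal (𝓞 F)⁰ F)ˣ) (I : InvIdeal R) :
    I.smulIdeal (𝔞 * 𝔟) = (I.smulIdeal 𝔟).smulIdeal 𝔞 :=
  InvIdeal.ext (by simp [InvIdeal.smulIdeal, idealMul_mul])

theorem smulIdeal_one (I : InvIdeal R) : I.smulIdeal 1 = I :=
  InvIdeal.ext (by simp [InvIdeal.smulIdeal, idealMul_one])

end InvIdeal

/-- If `σ ≡ 1` modulo `𝔪`, `σ b ∈ M` and `𝔪 b ⊆ M`, then `b ∈ M`. -/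
theorem mem_of_smul_mem {M : Submodule (𝓞 F) B} {𝔪 : Ideal (𝓞 F)} {σ : 𝓞 F} (hσ : σ - 1 ∈ 𝔪)
    {b : B} (hb : ∀ μ ∈ 𝔪, μ • b ∈ M) (h : σ • b ∈ M) : b ∈ M := by
  have : b = σ • b - (σ - 1) • b := by rw [sub_smul, one_smul, sub_sub_cancel]
  exact this ▸ M.sub_mem h (hb _ hσ)

section

variable (hB : IsQuaternionAlgebra F B) (hR : IsOrder R) {𝔪 : Ideal (𝓞 F)} (h𝔪 : 𝔪 ≠ ⊥)
  {I J : InvIdeal R}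
include hB hR h𝔪

/-- Locally I = Rx, J = Ry and yx⁻¹ ∈ R has norm of the same valuation as a generator ξ of 𝔪. By
conjugation ξ(yx⁻¹)⁻¹ ∈ R, that is ξx ∈ Ry. -/
theorem idealMul_le_of_mem_heckeSet (h : J ∈ heckeSet 𝔪 I) :
    idealMul (Submodule.map (Algebra.linearMap (𝓞 F) F) 𝔪) I.carrier ≤ J.carrier := by
  obtain ⟨hle, hN⟩ := (mem_heckeSet_iff hB hR h𝔪).1 h
  refine le_of_localize_le fun p => ?_
  obtain ⟨x, hx⟩ := I.locallyPrincipal p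
  obtain ⟨y, hy⟩ := J.locallyPrincipal p
  obtain ⟨ξ, hξ⟩ := exists_isLocalValue_ideal h𝔪 p
  have hv := (hB.isLocalValue_normIdeal hR hy).unique
    (hN ▸ hξ.mul (hB.isLocalValue_normIdeal hR hx))
  have hx0 := (Valuation.ne_zero_iff (p.valuation F)).2 (hB.reducedNorm_unit_ne_zero x)
  have hyx : ((y * x⁻¹ : Bˣ) : B) ∈ localize p (Subalgebra.toSubmodule R) := by
    have : (y : B) ∈ localize p I.carrier := localize_mono p hle <| by
      rw [hy, mem_rtrans_unit, Units.mul_inv]; exact le_localize p _ R.one_mem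
    rwa [hx, mem_rtrans_unit] at this
  have hinv := hB.smul_inv_mem_localize hR hyx (c := ξ) <| by
    rw [Units.val_mul, hB.reducedNorm_mul, hB.reducedNorm_inv, map_mul, map_inv₀, hv,
      mul_inv_cancel_right₀ hx0]
  rw [localize_idealMul hξ, hx, rtrans_rtrans]
  intro b hb
  obtain ⟨z, hz, rfl⟩ := mem_rtrans.1 hb
  rw [hy, mem_rtrans_unit]
  have hmul := mul_mem_localize (K := Subalgebra.toSubmodule R)
    (Submodule.mul_le.2 fun _ ha _ hb => R.mul_mem ha hb) hz hinv
  convert hmul using 1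
  have : (scalarUnit (B := B) ξ : B) = algebraMap F B ξ := rfl
  rw [this, mul_inv_rev, inv_inv, Units.val_mul, Algebra.smul_def, ← Algebra.commutes, mul_assoc,
    mul_assoc]

theorem smul_mem_of_mem_heckeSet (h : J ∈ heckeSet 𝔪 I) {μ : 𝓞 F} (hμ : μ ∈ 𝔪) {b : B}
    (hb : b ∈ I.carrier) : μ • b ∈ J.carrier := by
  refine idealMul_le_of_mem_heckeSet hB hR h𝔪 h ?_
  rw [← algebraMap_smul F, Algebra.smul_def]
  exact Submodule.mul_mem_mul ⟨_, ⟨μ, hμ, rfl⟩, rfl⟩ hb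

theorem smulIdeal_mem_heckeSet_smulIdeal (𝔟 : (FractionalIdeal (𝓞 F)⁰ F)ˣ)
    (h : J ∈ heckeSet 𝔪 I) : J.smulIdeal 𝔟 ∈ heckeSet 𝔪 (I.smulIdeal 𝔟) := by
  rw [mem_heckeSet_iff hB hR h𝔪] at h ⊢
  refine ⟨idealMul_mono le_rfl h.1, ?_⟩
  rw [InvIdeal.normIdeal_smulIdeal hB hR, InvIdeal.normIdeal_smulIdeal hB hR, h.2, mul_left_comm]

/-- If `J ∈ t_𝔪(I)`, then `𝔪 I ∈ t_𝔪(J)`. -/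
theorem smulIdeal_mem_heckeSet {𝔞 : (FractionalIdeal (𝓞 F)⁰ F)ˣ}
    (h𝔞 : ((𝔞 : FractionalIdeal (𝓞 F)⁰ F) : Submodule (𝓞 F) F) =
      Submodule.map (Algebra.linearMap (𝓞 F) F) 𝔪) (h : J ∈ heckeSet 𝔪 I) :
    I.smulIdeal 𝔞 ∈ heckeSet 𝔪 J := by
  refine (mem_heckeSet_iff hB hR h𝔪).2
    ⟨(congrArg (fun A => idealMul A I.carrier) h𝔞).trans_le
      (idealMul_le_of_mem_heckeSet hB hR h𝔪 h), ?_⟩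
  rw [InvIdeal.normIdeal_smulIdeal hB hR, ((mem_heckeSet_iff hB hR h𝔪).1 h).2, h𝔞, mul_assoc]

/-- The adjointness of `T_𝔪` and `[𝔪]⁻¹ T_𝔪` on the level of ideals. -/
theorem rmul_mem_heckeSet_iff {𝔞 : (FractionalIdeal (𝓞 F)⁰ F)ˣ}
    (h𝔞 : ((𝔞 : FractionalIdeal (𝓞 F)⁰ F) : Submodule (𝓞 F) F) =
      Submodule.map (Algebra.linearMap (𝓞 F) F) 𝔪) (x : Bˣ) :
    J.rmul x ∈ heckeSet 𝔪 I ↔ (I.smulIdeal 𝔞).rmul x⁻¹ ∈ heckeSet 𝔪 J := by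
  constructor <;> intro h
  · have := rmul_mem_heckeSet (smulIdeal_mem_heckeSet hB hR h𝔪 h𝔞 h) x⁻¹
    rwa [InvIdeal.rmul_rmul, mul_inv_cancel, InvIdeal.rmul_one] at this
  · have := rmul_mem_heckeSet (smulIdeal_mem_heckeSet hB hR h𝔪 h𝔞 h) x
    rw [InvIdeal.rmul_rmul, inv_mul_cancel, InvIdeal.rmul_one, ← InvIdeal.smulIdeal_rmul] at this
    have := smulIdeal_mem_heckeSet_smulIdeal hB hR h𝔪 𝔞⁻¹ this
    rwa [← InvIdeal.smulIdeal_mul, ← InvIdeal.smulIdeal_mul, inv_mul_cancel,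
      InvIdeal.smulIdeal_one, InvIdeal.smulIdeal_one] at this

end

/-- Between `N I` and `I` there are only finitely many lattices. -/
theorem finite_setOf_submodule_between {I : Submodule (𝓞 F) B} (hI : I.FG) {N : 𝓞 F} (hN : N ≠ 0) :
    {J : Submodule (𝓞 F) B | J ≤ I ∧ ∀ b ∈ I, N • b ∈ J}.Finite := by
  have : Module.Finite (𝓞 F) I := Module.Finite.iff_fg.2 hI
  have : Finite (𝓞 F ⧸ Ideal.span {N}) :=
    Ring.HasFiniteQuotients.finiteQuotient (by simpa using hN)
  have : Finite (I ⧸ Ideal.span {N} • (⊤ : Submodule (𝓞 F) I)) :=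
    Submodule.finite_quotient_smul _ Module.Finite.fg_top
  let q := (Ideal.span {N} • (⊤ : Submodule (𝓞 F) I)).mkQ
  -- As J contains N I, it is the preimage of its image in the finite module I / N I.
  refine Set.Finite.of_finite_image (f := fun J => SetLike.coe ((J.comap I.subtype).map q))
    (Set.toFinite _) ?_
  have key : ∀ J ∈ {J : Submodule (𝓞 F) B | J ≤ I ∧ ∀ b ∈ I, N • b ∈ J},
      ((J.comap I.subtype).map q).comap q = J.comap I.subtype := by
    rintro J ⟨-, hNJ⟩
    rw [Submodule.comap_map_eq, Submodule.ker_mkQ, sup_eq_left, Submodule.smul_le]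
    intro r hr n _
    obtain ⟨c, rfl⟩ := Ideal.mem_span_singleton'.1 hr
    simpa [mul_smul] using J.smul_mem c (hNJ n n.2)
  intro J hJ J' hJ' h
  have h' : J.comap I.subtype = J'.comap I.subtype := by
    rw [← key J hJ, ← key J' hJ', SetLike.coe_injective h]
  ext b
  constructor <;> intro hb
  · exact (SetLike.ext_iff.1 h' ⟨b, hJ.1 hb⟩).1 hb
  · exact (SetLike.ext_iff.1 h' ⟨b, hJ'.1 hb⟩).2 hb

theorem finite_setOf_invIdeal_between (I : Submodule (𝓞 F) B) (hI : I.FG) {N : 𝓞 F} (hN : N ≠ 0) :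
    {J : InvIdeal R | J.carrier ≤ I ∧ ∀ b ∈ I, N • b ∈ J.carrier}.Finite :=
  Set.Finite.preimage (f := InvIdeal.carrier) (fun _ _ _ _ h => InvIdeal.ext h)
    (finite_setOf_submodule_between hI hN)

theorem finite_heckeSet (hB : IsQuaternionAlgebra F B) (hR : IsOrder R) {𝔪 : Ideal (𝓞 F)}
    (h𝔪 : 𝔪 ≠ ⊥) (I : InvIdeal R) : (heckeSet 𝔪 I).Finite := by
  obtain ⟨N, hN, hN0⟩ := Submodule.exists_mem_ne_zero_of_ne_bot h𝔪
  exact (finite_setOf_invIdeal_between I.carrier I.isLattice.fg hN0).subset fun J hJ =>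
    ⟨hJ.1, fun b hb => smul_mem_of_mem_heckeSet hB hR h𝔪 hJ hN hb⟩

/-! ### The cardinality of `t_𝔪(I)` -/

open scoped Pointwise in
-- A local generator may be changed modulo pI, by Nakayama: I = Rb + pI gives an r ≡ 1 modulo p with
-- rI ⊆ Rb. Then Rb contains a nonzero scalar, so b has nonzero norm.
theorem exists_unit_localize_eq (hB : IsQuaternionAlgebra F B) (I : InvIdeal R)
    {p : HeightOneSpectrum (𝓞 F)} {x : Bˣ}
    (hx : localize p I.carrier = rtrans (localize p (Subalgebra.toSubmodule R)) x)
    {t : 𝓞 F} (ht : t ∉ p.asIdeal) {b : B} (hb : b ∈ I.carrier)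
    (htb : b - t • (x : B) ∈ p.asIdeal • I.carrier) :
    IsUnit b ∧ localize p I.carrier = rtrans (localize p (Subalgebra.toSubmodule R)) b := by
  set Rb := rtrans (Subalgebra.toSubmodule R) b with hRb
  have hle : I.carrier ≤ Rb ⊔ p.asIdeal • I.carrier := by
    intro y hy
    have hy' := le_localize p _ hy
    rw [hx, mem_rtrans_unit] at hy'
    obtain ⟨u, hu, huy⟩ := hy'
    have htu : t * u ∉ p.asIdeal := fun h => (p.isPrime.mem_or_mem h).elim ht hu
    obtain ⟨c, hc⟩ : ∃ c, 1 - c * (t * u) ∈ p.asIdeal := by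
      have := p.isMaximal
      obtain ⟨c, i, hi, hci⟩ := Ideal.IsMaximal.exists_inv this htu
      exact ⟨c, by rw [← hci, add_sub_cancel_left]; exact hi⟩
    set z := u • (y * ((x⁻¹ : Bˣ) : B)) with hz
    have h1 : (t * u) • y = z * b - z * (b - t • (x : B)) := by
      rw [mul_sub, sub_sub_cancel, hz, mul_smul_comm, smul_mul_assoc, Units.inv_mul_cancel_right,
        mul_smul]
    have h2 : z * (b - t • (x : B)) ∈ p.asIdeal • I.carrier := by
      refine Submodule.smul_induction_on htb (fun r hr n hn => ?_) fun m n hm hn => ?_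
      · rw [mul_smul_comm]
        exact Submodule.smul_mem_smul hr (I.mul_le (Submodule.mul_mem_mul huy hn))
      · rw [mul_add]; exact add_mem hm hn
    have h3 : (t * u) • y ∈ Rb ⊔ p.asIdeal • I.carrier := by
      rw [h1]
      exact sub_mem (Submodule.mem_sup_left (mem_rtrans.2 ⟨z, huy, rfl⟩))
        (Submodule.mem_sup_right h2)
    have h4 : y = c • (t * u) • y + (1 - c * (t * u)) • y := by
      rw [sub_smul, one_smul, mul_smul c, add_sub_cancel]
    rw [h4]
    exact add_mem (Submodule.smul_mem _ _ h3)
      (Submodule.mem_sup_right (Submodule.smul_mem_smul hc hy))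
  obtain ⟨r, hr, hrI⟩ := Submodule.exists_sub_one_mem_and_smul_le_of_fg_of_le_sup
    I.isLattice.fg le_rfl hle
  have hrp : r ∉ p.asIdeal := fun h => p.isPrime.ne_top ((Ideal.eq_top_iff_one _).2 (by
    have := sub_mem h hr
    rwa [sub_sub_cancel] at this))
  have hrI' : ∀ y ∈ I.carrier, r • y ∈ Rb := fun y hy =>
    hrI (Submodule.smul_mem_pointwise_smul y r _ hy)
  have hloc : localize p I.carrier = localize p Rb := by
    refine le_antisymm (localize_le_localize fun y hy => ⟨r, hrp, hrI' y hy⟩) (localize_mono p ?_)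
    intro y hy
    obtain ⟨z, hz, rfl⟩ := mem_rtrans.1 hy
    exact I.mul_le (Submodule.mul_mem_mul hz hb)
  have hunit : IsUnit b := by
    obtain ⟨d, hd, hdI⟩ := exists_nonZeroDivisor_smul_mem I.isLattice.span_eq_top (1 : B)
    obtain ⟨z, -, hz⟩ := mem_rtrans.1 (hrI' _ hdI)
    refine hB.isUnit_of_reducedNorm_ne_zero fun h0 => ?_
    have := hB.reducedNorm_mul z b
    rw [h0, mul_zero, hz, smul_smul, ← algebraMap_smul F, hB.reducedNorm_smul, hB.reducedNorm_one,
      mul_one, sq_eq_zero_iff, FaithfulSMul.algebraMap_eq_zero_iff, mul_eq_zero] at this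
    rcases this with h | h
    · exact hrp (h ▸ zero_mem _)
    · exact nonZeroDivisors.ne_zero hd h
  refine ⟨hunit, ?_⟩
  obtain ⟨b, rfl⟩ := hunit
  rw [hloc, hRb, localize_rtrans]

/-- Invertible ideals are principal at finitely many primes simultaneously. -/
theorem exists_semilocal_generator (hB : IsQuaternionAlgebra F B) (I : InvIdeal R)
    {𝔪 : Ideal (𝓞 F)} (h𝔪 : 𝔪 ≠ ⊥) : ∃ b : Bˣ, ∀ p : HeightOneSpectrum (𝓞 F), 𝔪 ≤ p.asIdeal →
      localize p I.carrier = rtrans (localize p (Subalgebra.toSubmodule R)) b := by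
  classical
  let S := {p : HeightOneSpectrum (𝓞 F) // 𝔪 ≤ p.asIdeal}
  have : Finite S := by
    have := Ideal.finite_factors h𝔪
    simp only [Ideal.dvd_iff_le] at this
    exact this.to_subtype
  have : Fintype S := Fintype.ofFinite S
  choose x hx using fun p : S => I.locallyPrincipal p.1
  have hxI : ∀ p : S, (x p : B) ∈ localize p.1 I.carrier := fun p => by
    rw [hx, mem_rtrans_unit, Units.mul_inv]
    exact le_localize _ _ R.one_mem
  choose t ht htI using hxI
  have hcop : Pairwise (Function.onFun IsCoprime fun p : S => p.1.asIdeal) := fun p q hpq => by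
    have := p.1.isMaximal
    have := q.1.isMaximal
    exact Ideal.isCoprime_of_isMaximal fun h => hpq (Subtype.ext (HeightOneSpectrum.ext h))
  -- Chinese remainders: e p is 1 modulo p and 0 modulo the other primes of S, so the sum b below
  -- agrees with the chosen local generator modulo q I at each q in S.
  choose e he using fun p : S => Ideal.exists_forall_sub_mem_ideal hcop (Pi.single p (1 : 𝓞 F))
  set b := ∑ p : S, e p • t p • (x p : B)
  have hb : b ∈ I.carrier := sum_mem fun p _ => I.carrier.smul_mem _ (htI p)
  have hbp : ∀ q : S, b - t q • (x q : B) ∈ q.1.asIdeal • I.carrier := fun q => by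
    have : b - t q • (x q : B) =
        ∑ p : S, (e p - (Pi.single p (1 : 𝓞 F) : S → 𝓞 F) q) • t p • (x p : B) := by
      simp only [sub_smul, Finset.sum_sub_distrib]
      congr 1
      rw [Finset.sum_eq_single q]
      · simp
      · intro p _ hpq
        simp [hpq.symm]
      · simp
    rw [this]
    exact sum_mem fun p _ => Submodule.smul_mem_smul (he p q) (htI p)
  have hfin := fun q : S => exists_unit_localize_eq hB I (hx q) (ht q) hb (hbp q)
  by_cases hS : Nonempty S
  · obtain ⟨q⟩ := hS
    obtain ⟨b', hb'⟩ := (hfin q).1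
    exact ⟨b', fun p hp => hb' ▸ (hfin ⟨p, hp⟩).2⟩
  · exact ⟨1, fun p hp => (hS ⟨⟨p, hp⟩⟩).elim⟩

/-- The multipliers taking I into J form an ideal that no prime containing 𝔪 contains; it is thus
coprime to 𝔪. -/
theorem exists_sub_one_mem_smul_mem {I J : Submodule (𝓞 F) B} (hI : I.FG) {𝔪 : Ideal (𝓞 F)}
    (h : ∀ p : HeightOneSpectrum (𝓞 F), 𝔪 ≤ p.asIdeal → localize p I ≤ localize p J) :
    ∃ σ : 𝓞 F, σ - 1 ∈ 𝔪 ∧ ∀ y ∈ I, σ • y ∈ J := by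
  let 𝔰 : Ideal (𝓞 F) :=
    { carrier := {s | ∀ y ∈ I, s • y ∈ J}
      zero_mem' := fun y _ => by simp
      add_mem' := fun {s t} hs ht y hy => by rw [add_smul]; exact J.add_mem (hs y hy) (ht y hy)
      smul_mem' := fun c s hs y hy => by
        rw [smul_eq_mul, mul_smul]; exact J.smul_mem c (hs y hy) }
  have htop : 𝔰 ⊔ 𝔪 = ⊤ := by
    by_contra hne
    obtain ⟨p, hp⟩ := exists_heightOneSpectrum_le hne
    obtain ⟨s, hs, hsI⟩ := exists_smul_mem_of_le_localize hI
      ((le_localize p I).trans (h p (le_sup_right.trans hp)))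
    exact hs (hp (Ideal.mem_sup_left hsI))
  obtain ⟨s, hs, m, hm, hsm⟩ := Submodule.mem_sup.1
    (show (1 : 𝓞 F) ∈ 𝔰 ⊔ 𝔪 from htop ▸ Submodule.mem_top)
  exact ⟨s, by rw [← hsm, sub_add_cancel_left]; exact neg_mem hm, hs⟩

section

variable (hB : IsQuaternionAlgebra F B) (hR : IsOrder R) {𝔪 : Ideal (𝓞 F)} (h𝔪 : 𝔪 ≠ ⊥)
include hB hR h𝔪

/-- The lattice K glues J at the primes dividing 𝔪 to I' at the others: σ is a unit at the former,
and at the latter K is all of I' because 𝔪I' ⊆ K. Local principality and the norm are then read off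
prime by prime. -/
theorem exists_mem_heckeSet_transfer {I I' : InvIdeal R} {σ : 𝓞 F} (hσ : σ - 1 ∈ 𝔪)
    (hI : ∀ y ∈ I.carrier, σ • y ∈ I'.carrier) (hI' : ∀ y ∈ I'.carrier, σ • y ∈ I.carrier)
    {J : InvIdeal R} (hJ : J ∈ heckeSet 𝔪 I) : ∃ K ∈ heckeSet 𝔪 I',
      ∀ y, y ∈ K.carrier ↔ y ∈ I'.carrier ∧ σ • y ∈ J.carrier := by
  have hmJ : ∀ μ ∈ 𝔪, ∀ b ∈ I.carrier, μ • b ∈ J.carrier := fun μ hμ b hb =>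
    smul_mem_of_mem_heckeSet hB hR h𝔪 hJ hμ hb
  let K : Submodule (𝓞 F) B := I'.carrier ⊓ J.carrier.comap (LinearMap.lsmul (𝓞 F) B σ)
  have hK : ∀ y, y ∈ K ↔ y ∈ I'.carrier ∧ σ • y ∈ J.carrier := fun y => Iff.rfl
  have hmK : ∀ μ ∈ 𝔪, ∀ b ∈ I'.carrier, μ • b ∈ K := fun μ hμ b hb =>
    ⟨I'.carrier.smul_mem _ hb, by
      rw [SetLike.mem_coe, Submodule.mem_comap, LinearMap.lsmul_apply, smul_comm]
      exact hmJ μ hμ _ (hI' b hb)⟩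
  have hdvd : ∀ p : HeightOneSpectrum (𝓞 F), 𝔪 ≤ p.asIdeal →
      σ ∉ p.asIdeal ∧ localize p K = localize p J.carrier ∧
        localize p I'.carrier = localize p I.carrier := fun p hp => by
    have hσp : σ ∉ p.asIdeal := fun h => p.isPrime.ne_top ((Ideal.eq_top_iff_one _).2 (by
      have := sub_mem h (hp hσ)
      rwa [sub_sub_cancel] at this))
    refine ⟨hσp, ?_, ?_⟩
    · refine le_antisymm (localize_le_localize fun y hy => ⟨σ, hσp, hy.2⟩)
        (localize_le_localize fun y hy => ⟨σ, hσp, hI y (hJ.1 hy), ?_⟩)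
      exact J.carrier.smul_mem _ (J.carrier.smul_mem _ hy)
    · exact le_antisymm (localize_le_localize fun y hy => ⟨σ, hσp, hI' y hy⟩)
        (localize_le_localize fun y hy => ⟨σ, hσp, hI y hy⟩)
  have hndvd : ∀ p : HeightOneSpectrum (𝓞 F), ¬ 𝔪 ≤ p.asIdeal →
      localize p K = localize p I'.carrier ∧
      IsLocalValue p (Submodule.map (Algebra.linearMap (𝓞 F) F) 𝔪) 1 := fun p hp => by
    obtain ⟨μ, hμ, hμp⟩ := SetLike.not_le_iff_exists.1 hp
    refine ⟨le_antisymm (localize_mono p inf_le_left)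
      (localize_le_localize fun y hy => ⟨μ, hμp, hmK μ hμ y hy⟩),
      ⟨⟨_, ⟨μ, hμ, rfl⟩, p.valuation_eq_one_iff_notMem.2 hμp⟩, ?_⟩⟩
    rintro _ ⟨_, ⟨x, -, rfl⟩, rfl⟩
    exact p.valuation_le_one x
  let K' : InvIdeal R :=
    { carrier := K
      isLattice :=
        { fg := by
            have : IsNoetherian (𝓞 F) I'.carrier := isNoetherian_of_fg_of_noetherian _
              I'.isLattice.fg
            have := isNoetherian_of_le (inf_le_left : K ≤ I'.carrier)
            exact (isNoetherian_submodule.1 this) K le_rfl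
          span_eq_top := by
            obtain ⟨N, hN, hN0⟩ := Submodule.exists_mem_ne_zero_of_ne_bot h𝔪
            rw [eq_top_iff, ← I'.isLattice.span_eq_top, Submodule.span_le]
            intro y hy
            have hN0' : algebraMap (𝓞 F) F N ≠ 0 := by simpa using hN0
            have : y = (algebraMap (𝓞 F) F N)⁻¹ • (N • y) := by
              rw [← algebraMap_smul F N, inv_smul_smul₀ hN0']
            rw [SetLike.mem_coe, this]
            exact Submodule.smul_mem _ _ (Submodule.subset_span (hmK N hN y hy)) }
      mul_le := by
        refine Submodule.mul_le.2 fun r hr y hy => ⟨I'.mul_le (Submodule.mul_mem_mul hr hy.1), ?_⟩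
        rw [SetLike.mem_coe, Submodule.mem_comap, LinearMap.lsmul_apply, ← mul_smul_comm]
        exact J.mul_le (Submodule.mul_mem_mul hr hy.2)
      locallyPrincipal := fun p => by
        by_cases hp : 𝔪 ≤ p.asIdeal
        · rw [(hdvd p hp).2.1]
          exact J.locallyPrincipal p
        · rw [(hndvd p hp).1]
          exact I'.locallyPrincipal p }
  refine ⟨K', (mem_heckeSet_iff hB hR h𝔪).2 ⟨inf_le_left, eq_of_isLocalValue fun p => ?_⟩, hK⟩
  by_cases hp : 𝔪 ≤ p.asIdeal
  · obtain ⟨-, h1, h2⟩ := hdvd p hp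
    obtain ⟨x, hx⟩ := I.locallyPrincipal p
    obtain ⟨y, hy⟩ := J.locallyPrincipal p
    obtain ⟨ξ, hξ⟩ := exists_isLocalValue_ideal h𝔪 p
    refine ⟨_, hB.isLocalValue_normIdeal hR (h1.trans hy), ?_⟩
    have h3 := hξ.mul (hB.isLocalValue_normIdeal hR hx)
    rw [(hB.isLocalValue_normIdeal hR hy).unique (((mem_heckeSet_iff hB hR h𝔪).1 hJ).2 ▸ h3)]
    exact hξ.mul (hB.isLocalValue_normIdeal hR (h2.trans hx))
  · obtain ⟨h1, h2⟩ := hndvd p hp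
    obtain ⟨x, hx⟩ := I'.locallyPrincipal p
    refine ⟨_, hB.isLocalValue_normIdeal hR (h1.trans hx), ?_⟩
    have := h2.mul (hB.isLocalValue_normIdeal hR hx)
    rwa [one_mul] at this

/-- The transfer J ↦ K is injective because J = {y ∈ I : σy ∈ K}: if σ²y ∈ J, then y ∈ J, since σ ≡
1 modulo 𝔪 and 𝔪I ⊆ J. -/
theorem ncard_heckeSet_le_of_transfer {I I' : InvIdeal R} {σ : 𝓞 F} (hσ : σ - 1 ∈ 𝔪)
    (hI : ∀ y ∈ I.carrier, σ • y ∈ I'.carrier) (hI' : ∀ y ∈ I'.carrier, σ • y ∈ I.carrier) :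
    (heckeSet 𝔪 I).ncard ≤ (heckeSet 𝔪 I').ncard := by
  choose! f hf hfK using fun J (hJ : J ∈ heckeSet 𝔪 I) =>
    exists_mem_heckeSet_transfer hB hR h𝔪 hσ hI hI' hJ
  have hrec : ∀ J ∈ heckeSet 𝔪 I, ∀ y,
      y ∈ J.carrier ↔ y ∈ I.carrier ∧ σ • y ∈ (f J).carrier := fun J hJ y => by
    rw [hfK J hJ]
    refine ⟨fun hy => ⟨hJ.1 hy, hI y (hJ.1 hy), J.carrier.smul_mem _ (J.carrier.smul_mem _ hy)⟩,
      fun ⟨hy, _, h⟩ => ?_⟩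
    have hm : ∀ b ∈ I.carrier, ∀ μ ∈ 𝔪, μ • b ∈ J.carrier := fun b hb μ hμ =>
      smul_mem_of_mem_heckeSet hB hR h𝔪 hJ hμ hb
    exact mem_of_smul_mem hσ (hm y hy)
      (mem_of_smul_mem hσ (hm _ (I.carrier.smul_mem _ hy)) h)
  refine Set.ncard_le_ncard_of_injOn f hf (fun J hJ J' hJ' h => InvIdeal.ext ?_)
    (finite_heckeSet hB hR h𝔪 I')
  ext y
  rw [hrec J hJ, hrec J' hJ', h]

theorem ncard_heckeSet_rmul (I : InvIdeal R) (x : Bˣ) :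
    (heckeSet 𝔪 (I.rmul x)).ncard = (heckeSet 𝔪 I).ncard := by
  have key : ∀ (I : InvIdeal R) (x : Bˣ),
      (heckeSet 𝔪 I).ncard ≤ (heckeSet 𝔪 (I.rmul x)).ncard := fun I x =>
    Set.ncard_le_ncard_of_injOn (fun J => J.rmul x) (fun J hJ => rmul_mem_heckeSet hJ x)
      (fun J _ J' _ h => by
        have := congrArg (fun L : InvIdeal R => L.rmul x⁻¹) h
        simpa only [InvIdeal.rmul_rmul, mul_inv_cancel, InvIdeal.rmul_one] using this)
      (finite_heckeSet hB hR h𝔪 _)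
  refine le_antisymm ?_ (key I x)
  have := key (I.rmul x) x⁻¹
  rwa [InvIdeal.rmul_rmul, mul_inv_cancel, InvIdeal.rmul_one] at this

/-- The number of elements of `t_𝔪(I)` does not depend on `I`. -/
theorem ncard_heckeSet_eq (I I' : InvIdeal R) :
    (heckeSet 𝔪 I).ncard = (heckeSet 𝔪 I').ncard := by
  obtain ⟨b, hb⟩ := exists_semilocal_generator hB I h𝔪
  obtain ⟨b', hb'⟩ := exists_semilocal_generator hB I' h𝔪
  rw [← ncard_heckeSet_rmul hB hR h𝔪 I' (b'⁻¹ * b)]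
  -- This translate of I' has the same localizations as I at all primes dividing 𝔪.
  set L := I'.rmul (b'⁻¹ * b)
  have hL : ∀ p : HeightOneSpectrum (𝓞 F), 𝔪 ≤ p.asIdeal →
      localize p L.carrier = localize p I.carrier := fun p hp => by
    rw [hb p hp]
    refine (localize_rtrans p I'.carrier _).trans ?_
    rw [hb' p hp, rtrans_rtrans, ← Units.val_mul, mul_inv_cancel_left]
  obtain ⟨σ, hσ, h1⟩ := exists_sub_one_mem_smul_mem I.isLattice.fg fun p hp => (hL p hp).ge
  obtain ⟨τ, hτ, h2⟩ := exists_sub_one_mem_smul_mem L.isLattice.fg fun p hp => (hL p hp).le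
  -- The transfer needs one multiplier for both directions; the product of σ and τ is one.
  have hστ : σ * τ - 1 ∈ 𝔪 := by
    have : σ * τ - 1 = σ * (τ - 1) + (σ - 1) := by ring
    exact this ▸ add_mem (Ideal.mul_mem_left _ _ hτ) hσ
  have h3 : ∀ y ∈ I.carrier, (σ * τ) • y ∈ L.carrier := fun y hy => by
    rw [mul_comm, mul_smul]; exact L.carrier.smul_mem _ (h1 y hy)
  have h4 : ∀ y ∈ L.carrier, (σ * τ) • y ∈ I.carrier := fun y hy => by
    rw [mul_smul]; exact I.carrier.smul_mem _ (h2 y hy)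
  exact le_antisymm (ncard_heckeSet_le_of_transfer hB hR h𝔪 hστ h3 h4)
    (ncard_heckeSet_le_of_transfer hB hR h𝔪 hστ h4 h3)

end

end Hecke

/-! ### Positive definiteness of the reduced norm -/

section Definite

variable {F B : Type*} [Field F] [Ring B] [Algebra F B]

/-- If `B` is totally definite and `i² = a`, then `a` is negative at every real place. -/
theorem IsTotallyDefinite.map_neg (hdef : IsTotallyDefinite F B) (τ : F →+* ℝ) {a : F} {i : B}
    (hi : i * i = algebraMap F B a) (f : B →ₗ[F] F) (h1 : f 1 = 0) (hfi : f i = 1) : τ a < 0 := by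
  by_contra hcon
  push Not at hcon
  let : Algebra F ℝ := τ.toAlgebra
  have hr := Real.mul_self_sqrt hcon
  set r := √(τ a) with hr_def
  -- If τ a ≥ 0, then i² - a factors over ℝ, giving zero divisors r - i and r + i. The functional f,
  -- which kills 1 and not i, shows that both are nonzero.
  let z : ℝ ⊗[F] B := r ⊗ₜ 1 - 1 ⊗ₜ i
  let w : ℝ ⊗[F] B := r ⊗ₜ 1 + 1 ⊗ₜ i
  have hzw : z * w = 0 := by
    have : (1 : ℝ) ⊗ₜ[F] (algebraMap F B a) = τ a ⊗ₜ[F] (1 : B) := by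
      rw [Algebra.algebraMap_eq_smul_one, ← TensorProduct.smul_tmul, Algebra.smul_def, mul_one]
      rfl
    simp only [z, w, sub_mul, mul_add, Algebra.TensorProduct.tmul_mul_tmul, one_mul, mul_one, hr, hi,
      this]
    abel
  have hz : z ≠ 0 := fun h0 => by
    have := congrArg ((TensorProduct.rid F ℝ) ∘ (LinearMap.lTensor ℝ f)) h0
    simp [z, h1, hfi] at this
  have hw : w ≠ 0 := fun h0 => by
    have := congrArg ((TensorProduct.rid F ℝ) ∘ (LinearMap.lTensor ℝ f)) h0
    simp [w, h1, hfi] at this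
  exact hw ((hdef τ z hz).mul_right_eq_zero.1 hzw)

/-- A totally definite quaternion algebra has the form `(a, b)` with `a` and `b` totally
negative. -/
theorem IsQuaternionAlgebra.exists_totally_negative (hB : IsQuaternionAlgebra F B)
    (hdef : IsTotallyDefinite F B) : ∃ a b : F, (∀ τ : F →+* ℝ, τ a < 0 ∧ τ b < 0) ∧
      Nonempty (B ≃ₐ[F] ℍ[F, a, b]) := by
  obtain ⟨a, b, -, -, ⟨e⟩⟩ := hB
  refine ⟨a, b, fun τ => ?_, ⟨e⟩⟩
  let c := fun n => ((QuaternionAlgebra.basisOneIJK a 0 b).coord n).comp e.toLinearMap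
  have hc : ∀ n y, c n y = ![(e y).re, (e y).imI, (e y).imJ, (e y).imK] n := fun n y => by
    rw [← QuaternionAlgebra.coe_basisOneIJK_repr]; rfl
  constructor
  · refine hdef.map_neg τ (i := e.symm ⟨0, 1, 0, 0⟩) ?_ (c 1) ?_ ?_
    · apply e.injective
      rw [map_mul, e.apply_symm_apply, e.commutes]
      ext <;> simp [QuaternionAlgebra.algebraMap_eq]
    all_goals simp [hc]
  · refine hdef.map_neg τ (i := e.symm ⟨0, 0, 1, 0⟩) ?_ (c 2) ?_ ?_
    · apply e.injective
      rw [map_mul, e.apply_symm_apply, e.commutes]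
      ext <;> simp [QuaternionAlgebra.algebraMap_eq]
    all_goals simp [hc]

theorem map_reducedNorm_quaternion {a b : F} [CharZero F] (τ : F →+* ℝ) (x : ℍ[F, a, b]) :
    τ (reducedNorm F x) = τ x.re ^ 2 + -τ a * τ x.imI ^ 2 + -τ b * τ x.imJ ^ 2 +
      τ a * τ b * τ x.imK ^ 2 := by
  rw [reducedNorm_quaternion]
  simp only [map_add, map_sub, map_mul, map_pow]
  ring

theorem map_le_map_reducedNorm_quaternion {a b : F} [CharZero F] {τ : F →+* ℝ}
    (ha : τ a < 0) (hb : τ b < 0) (x : ℍ[F, a, b]) :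
    (1 * τ x.re ^ 2 ≤ τ (reducedNorm F x) ∧ -τ a * τ x.imI ^ 2 ≤ τ (reducedNorm F x)) ∧
    (-τ b * τ x.imJ ^ 2 ≤ τ (reducedNorm F x) ∧
      τ a * τ b * τ x.imK ^ 2 ≤ τ (reducedNorm F x)) := by
  rw [map_reducedNorm_quaternion]
  have h0 := sq_nonneg (τ x.re)
  have h1 := mul_nonneg (neg_nonneg.2 ha.le) (sq_nonneg (τ x.imI))
  have h2 := mul_nonneg (neg_nonneg.2 hb.le) (sq_nonneg (τ x.imJ))
  have h3 := mul_nonneg (mul_nonneg_of_nonpos_of_nonpos ha.le hb.le) (sq_nonneg (τ x.imK))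
  refine ⟨⟨?_, ?_⟩, ?_, ?_⟩ <;> linarith

/-- The real embedding through which a complex embedding of a totally real field factors. -/
theorem exists_realEmbedding [IsTotallyReal F] (φ : F →+* ℂ) :
    ∃ τ : F →+* ℝ, ∀ x, ‖φ x‖ = |τ x| :=
  ⟨(IsTotallyReal.complexEmbedding_isReal φ).embedding, fun x => by
    rw [← ComplexEmbedding.IsReal.coe_embedding_apply (IsTotallyReal.complexEmbedding_isReal φ),
      Complex.norm_real, Real.norm_eq_abs]⟩

variable [NumberField F] [IsTotallyReal F]

theorem reducedNorm_ne_zero (hB : IsQuaternionAlgebra F B) (hdef : IsTotallyDefinite F B) {x : B}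
    (hx : x ≠ 0) : reducedNorm F x ≠ 0 := by
  obtain ⟨a, b, hab, ⟨e⟩⟩ := hB.exists_totally_negative hdef
  obtain ⟨τ, -⟩ := exists_realEmbedding (Classical.arbitrary (F →+* ℂ))
  obtain ⟨ha, hb⟩ := hab τ
  rw [← reducedNorm_algEquiv e]
  intro h0
  obtain ⟨⟨h1, h2⟩, h3, h4⟩ := map_le_map_reducedNorm_quaternion ha hb (e x)
  rw [h0, map_zero] at h1 h2 h3 h4
  have key : ∀ {m t : ℝ}, 0 < m → m * t ^ 2 ≤ 0 → t = 0 := fun hm ht => by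
    have := nonpos_of_mul_nonpos_right ht hm
    exact pow_eq_zero_iff two_ne_zero |>.1 (le_antisymm this (sq_nonneg _))
  refine hx (e.injective ?_)
  rw [map_zero]
  ext
  · exact (map_eq_zero τ).1 (key one_pos h1)
  · exact (map_eq_zero τ).1 (key (neg_pos.2 ha) h2)
  · exact (map_eq_zero τ).1 (key (neg_pos.2 hb) h3)
  · exact (map_eq_zero τ).1 (key (mul_pos_of_neg_of_neg ha hb) h4)

theorem isUnit_of_ne_zero (hB : IsQuaternionAlgebra F B) (hdef : IsTotallyDefinite F B) {x : B}
    (hx : x ≠ 0) : IsUnit x :=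
  hB.isUnit_of_reducedNorm_ne_zero (reducedNorm_ne_zero hB hdef hx)

/-- The numbers d z are algebraic integers with bounded conjugates. The bound |f| + 1 comes from |t|
≤ t² + 1 and avoids a square root; the sum over embeddings makes it uniform. -/
theorem finite_setOf_isIntegral_bounded {d : F} (hd : d ≠ 0) (f : (F →+* ℝ) → ℝ) :
    {z : F | IsIntegral (𝓞 F) (d * z) ∧ ∀ τ : F →+* ℝ, τ z ^ 2 ≤ f τ}.Finite := by
  choose ρ hρ using exists_realEmbedding (F := F)
  have hsub := (Embeddings.finite_of_norm_le F ℂ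
    (∑ φ : F →+* ℂ, |ρ φ d| * (|f (ρ φ)| + 1))).preimage (mul_right_injective₀ hd).injOn
  refine hsub.subset fun z hz => ⟨isIntegral_trans (R := ℤ) (A := 𝓞 F) _ hz.1, fun φ => ?_⟩
  refine le_trans ?_ (Finset.single_le_sum (f := fun φ => |ρ φ d| * (|f (ρ φ)| + 1))
    (fun _ _ => by positivity) (Finset.mem_univ φ))
  simp only
  rw [map_mul, norm_mul, hρ, hρ]
  refine mul_le_mul_of_nonneg_left ?_ (abs_nonneg _)
  have h1 := (hz.2 (ρ φ)).trans (le_abs_self _)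
  have h2 : |ρ φ z| ^ 2 ≤ |f (ρ φ)| := by rwa [sq_abs]
  nlinarith [sq_nonneg (|ρ φ z| - 1), abs_nonneg (ρ φ z)]

/-- A lattice contains only finitely many elements with given reduced norm. -/
theorem finite_setOf_reducedNorm_eq (hB : IsQuaternionAlgebra F B)
    (hdef : IsTotallyDefinite F B) {d : F} (hd : d ≠ 0) {I : Submodule (𝓞 F) B} (hI : I.FG)
    (c : F) : {x : B | d • x ∈ I ∧ reducedNorm F x = c}.Finite := by
  obtain ⟨a, b, hab, ⟨e⟩⟩ := hB.exists_totally_negative hdef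
  let k : Fin 4 → B →ₗ[F] F := fun n =>
    ((QuaternionAlgebra.basisOneIJK a 0 b).coord n).comp e.toLinearMap
  have hk : ∀ n y, k n y = ![(e y).re, (e y).imI, (e y).imJ, (e y).imK] n := fun n y => by
    rw [← QuaternionAlgebra.coe_basisOneIJK_repr]; rfl
  have hfg : (⨆ n, I.map ((k n).restrictScalars (𝓞 F))).FG :=
    Submodule.fg_iSup _ fun n => hI.map _
  obtain ⟨s, hs, hsI⟩ := FractionalIdeal.isFractional_of_fg (S := (𝓞 F)⁰) hfg
  have hs0 : algebraMap (𝓞 F) F s ≠ 0 := by simpa using nonZeroDivisors.ne_zero hs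
  -- The norm form is diagonal with these totally positive coefficients, so each squared coordinate
  -- is at most τ c / τ (m n) at every real place τ.
  let m : Fin 4 → F := ![1, -a, -b, a * b]
  have hm : ∀ n (τ : F →+* ℝ), 0 < τ (m n) := fun n τ => by
    obtain ⟨ha, hb⟩ := hab τ
    fin_cases n
    · simp [m]
    · simpa [m] using ha
    · simpa [m] using hb
    · simpa [m] using mul_pos_of_neg_of_neg ha hb
  have hfin := Set.Finite.pi' fun n : Fin 4 => finite_setOf_isIntegral_bounded
    (mul_ne_zero hs0 hd) (fun τ => τ c / τ (m n))
  refine (hfin.preimage (f := fun y n => k n y) ?_).subset ?_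
  · intro x _ y _ hxy
    refine e.injective ((QuaternionAlgebra.basisOneIJK a 0 b).ext_elem fun n => congrFun hxy n)
  · rintro x ⟨hx, rfl⟩ n
    refine ⟨?_, fun τ => ?_⟩
    · obtain ⟨t, ht⟩ := hsI _ (Submodule.mem_iSup_of_mem n ⟨_, hx, rfl⟩)
      refine IsIntegrallyClosed.isIntegral_iff.2 ⟨t, ht.trans ?_⟩
      rw [LinearMap.restrictScalars_apply, map_smul, Algebra.smul_def, smul_eq_mul, mul_assoc]
    · rw [le_div_iff₀ (hm n τ), mul_comm]
      obtain ⟨ha, hb⟩ := hab τ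
      obtain ⟨⟨h1, h2⟩, h3, h4⟩ := map_le_map_reducedNorm_quaternion ha hb (e x)
      rw [reducedNorm_algEquiv] at h1 h2 h3 h4
      simp only [hk]
      fin_cases n
      · simpa [m] using h1
      · simpa [m] using h2
      · simpa [m] using h3
      · simpa [m] using h4

end Definite

/-! ### Finiteness of `⟨[I], [J]⟩` -/

section PairCount

variable {F B : Type*} [Field F] [NumberField F] [Ring B] [Algebra F B]

variable (F) in
/-- Dirichlet's unit theorem modulo squares. -/
theorem exists_finite_units_mul_sq : ∃ U : Set (𝓞 F)ˣ, U.Finite ∧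
    ∀ u : (𝓞 F)ˣ, ∃ w ∈ U, ∃ v : (𝓞 F)ˣ, u = w * v ^ 2 := by
  let H : Subgroup (𝓞 F)ˣ := (powMonoidHom 2 : (𝓞 F)ˣ →* (𝓞 F)ˣ).range
  have : Group.FG (𝓞 F)ˣ := Group.fg_iff_monoid_fg.2 inferInstance
  have : Finite ((𝓞 F)ˣ ⧸ H) := CommGroup.finite_of_fg_isMulTorsion _ fun x => by
    induction x using QuotientGroup.induction_on with
    | H u =>
      refine isOfFinOrder_iff_pow_eq_one.2 ⟨2, two_pos, ?_⟩
      rw [← QuotientGroup.mk_pow, QuotientGroup.eq_one_iff]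
      exact ⟨u, rfl⟩
  refine ⟨Set.range (Quotient.out : (𝓞 F)ˣ ⧸ H → (𝓞 F)ˣ), Set.finite_range _, fun u => ?_⟩
  obtain ⟨⟨_, v, rfl⟩, hv⟩ := QuotientGroup.mk_out_eq_mul H u
  refine ⟨_, ⟨(u : (𝓞 F)ˣ ⧸ H), rfl⟩, v⁻¹, ?_⟩
  rw [hv]
  simp

variable [IsTotallyReal F] {R : Subalgebra (𝓞 F) B} (hB : IsQuaternionAlgebra F B)
  (hdef : IsTotallyDefinite F B) (hR : IsOrder R)
include hB hR

/-- From N(I) = nrd(x) N(I), the norm of x has valuation 1 at every prime. -/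
theorem exists_unit_eq_reducedNorm {I : InvIdeal R} {x : Bˣ} (hx : I.rmul x = I) :
    ∃ u : (𝓞 F)ˣ, reducedNorm F (x : B) = algebraMap (𝓞 F) F u := by
  have hv : ∀ p : HeightOneSpectrum (𝓞 F), p.valuation F (reducedNorm F (x : B)) = 1 := fun p => by
    obtain ⟨g, hg0, hg⟩ := I.exists_isLocalValue_normIdeal hB hR p
    have h := (IsLocalValue.span_singleton p (reducedNorm F (x : B))).mul hg
    rw [← InvIdeal.normIdeal_rmul hB hR, hx] at h
    exact (mul_eq_right₀ hg0).1 (h.unique hg)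
  obtain ⟨s, hs⟩ := exists_algebraMap_eq_of_valuation_le_one fun p => (hv p).le
  obtain ⟨t, ht⟩ := exists_algebraMap_eq_of_valuation_le_one
    (x := (reducedNorm F (x : B))⁻¹) fun p => by rw [map_inv₀, hv p, inv_one]
  have hst : s * t = 1 := FaithfulSMul.algebraMap_injective (𝓞 F) F (by
    rw [map_mul, hs, ht, mul_inv_cancel₀ (hB.reducedNorm_unit_ne_zero x), map_one])
  exact ⟨⟨s, t, hst, by rw [mul_comm, hst]⟩, hs.symm⟩

include hdef

/-- Modulo units v, which change the norm by v², the norm of x may be taken in a finite set of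
representatives of units modulo squares. As s ∈ I gives s x ∈ I x = I, the denominators are bounded
too, and definiteness leaves finitely many x. -/
theorem finite_stabilizer (I : InvIdeal R) :
    ((QuotientGroup.mk : Bˣ → Bˣ ⧸ integerUnits F B) '' {x | I.rmul x = I}).Finite := by
  obtain ⟨U, hU, hUsq⟩ := exists_finite_units_mul_sq F
  obtain ⟨s, hs, hsI⟩ := exists_nonZeroDivisor_smul_mem I.isLattice.span_eq_top (1 : B)
  have hs0 : algebraMap (𝓞 F) F s ≠ 0 := by simpa using nonZeroDivisors.ne_zero hs
  have hfin := hU.biUnion fun u _ => finite_setOf_reducedNorm_eq hB hdef hs0 I.isLattice.fg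
    (algebraMap (𝓞 F) F (u : 𝓞 F))
  refine ((hfin.preimage (f := ((↑) : Bˣ → B)) Units.val_injective.injOn).image
    QuotientGroup.mk).subset ?_
  rintro _ ⟨x, hx, rfl⟩
  obtain ⟨u, hu⟩ := exists_unit_eq_reducedNorm hB hR hx
  obtain ⟨w, hw, v, rfl⟩ := hUsq u
  refine ⟨x * (Units.map (algebraMap (𝓞 F) B : 𝓞 F →* B) v⁻¹), ?_, ?_⟩
  · have hval : ((x * (Units.map (algebraMap (𝓞 F) B : 𝓞 F →* B) v⁻¹) : Bˣ) : B) =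
        ((v⁻¹ : (𝓞 F)ˣ) : 𝓞 F) • (x : B) := by
      rw [Algebra.smul_def, Algebra.commutes]; rfl
    refine Set.mem_iUnion₂.2 ⟨w, hw, ?_, ?_⟩
    · rw [hval, algebraMap_smul, smul_comm]
      refine I.carrier.smul_mem _ ?_
      have hmem : s • (x : B) ∈ (I.rmul x).carrier := mem_rtrans.2 ⟨_, hsI, by simp⟩
      rwa [hx] at hmem
    · rw [hval, ← algebraMap_smul F, hB.reducedNorm_smul, hu, ← map_pow, ← map_mul]
      congr 1
      rw [← Units.val_pow_eq_pow_val, ← Units.val_mul]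
      congr 1
      rw [mul_comm w, inv_pow, inv_mul_cancel_left]
  · rw [QuotientGroup.eq]
    exact ⟨v, by simp⟩

/-- Finiteness is essential: `Set.ncard` of an infinite set is 0. -/
theorem pairCount_self_ne_zero (I : InvIdeal R) : pairCount I I ≠ 0 :=
  Set.ncard_ne_zero_of_mem ⟨1, I.rmul_one, rfl⟩ (finite_stabilizer hB hdef hR I)

end PairCount

/-! ### Finiteness of the class set -/

section ClassNumber

variable {F B : Type*} [Field F] [NumberField F] [Ring B] [Algebra F B]

variable (F) in
/-- The absolute norm down to `ℚ` of the reduced norm. -/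
def absNorm (x : B) : ℚ := |Algebra.norm ℚ (reducedNorm F x)|

theorem absNorm_mul (hB : IsQuaternionAlgebra F B) (x y : B) :
    absNorm F (x * y) = absNorm F x * absNorm F y := by
  rw [absNorm, hB.reducedNorm_mul, map_mul, abs_mul]; rfl

theorem exists_nat_eq_absNorm (hB : IsQuaternionAlgebra F B) {R : Subalgebra (𝓞 F) B}
    (hR : IsOrder R) {x : B} (hx : x ∈ R) : ∃ n : ℕ, absNorm F x = n := by
  obtain ⟨s, hs⟩ := exists_algebraMap_eq_of_valuation_le_one fun p =>
    hB.valuation_reducedNorm_le_one hR (le_localize p (Subalgebra.toSubmodule R) hx)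
  have hint : IsIntegral ℤ (Algebra.norm ℚ (reducedNorm F x)) :=
    Algebra.isIntegral_norm ℚ (hs ▸ RingOfIntegers.isIntegral_coe s)
  obtain ⟨n, hn⟩ := IsIntegrallyClosed.isIntegral_iff.1 hint
  refine ⟨n.natAbs, ?_⟩
  rw [absNorm, ← hn, Nat.cast_natAbs, Int.cast_abs]
  rfl

/-- As a product over the embeddings of F, the norm extends to a continuous function of real
coordinates, vanishing at the origin. -/
theorem exists_absNorm_lt_one (hB : IsQuaternionAlgebra F B) {ι : Type*} [Fintype ι] (g : ι → B) :
    ∃ ε : ℝ, 0 < ε ∧ ∀ c : ι → ℚ, (∀ i, |(c i : ℝ)| < ε) →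
      absNorm F (∑ i, (c i : F) • g i) < 1 := by
  obtain ⟨a, b, -, -, ⟨e⟩⟩ := hB
  let k : Fin 4 → B →ₗ[F] F := fun n =>
    ((QuaternionAlgebra.basisOneIJK a 0 b).coord n).comp e.toLinearMap
  have hk : ∀ n y, k n y = ![(e y).re, (e y).imI, (e y).imJ, (e y).imK] n := fun n y => by
    rw [← QuaternionAlgebra.coe_basisOneIJK_repr]; rfl
  let q : (F →+* ℂ) → (Fin 4 → ℂ) → ℂ := fun φ y =>
    y 0 ^ 2 - φ a * y 1 ^ 2 - φ b * y 2 ^ 2 + φ a * φ b * y 3 ^ 2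
  have hq : ∀ (φ : F →+* ℂ) (y : B), φ (reducedNorm F y) = q φ fun n => φ (k n y) := fun φ y => by
    rw [← reducedNorm_algEquiv e, reducedNorm_quaternion]
    simp [q, hk]
  let P : (ι → ℝ) → ℂ := fun c => ∏ φ : F →ₐ[ℚ] ℂ, q φ fun n => ∑ i, (c i : ℂ) * φ (k n (g i))
  have hP : ∀ c : ι → ℚ, absNorm F (∑ i, (c i : F) • g i) = ‖P fun i => (c i : ℝ)‖ := fun c => by
    have h1 := Algebra.norm_eq_prod_embeddings ℚ ℂ (reducedNorm F (∑ i, (c i : F) • g i))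
    rw [absNorm, Rat.cast_abs, ← Real.norm_eq_abs, ← Complex.norm_real]
    have h2 : (((Algebra.norm ℚ (reducedNorm F (∑ i, (c i : F) • g i)) : ℚ) : ℝ) : ℂ) =
        P fun i => (c i : ℝ) := by
      rw [Complex.ofReal_ratCast, ← eq_ratCast (algebraMap ℚ ℂ), h1]
      refine Finset.prod_congr rfl fun φ _ => (hq φ _).trans ?_
      simp
    rw [h2]
  have hcont : Continuous fun c => ‖P c‖ := by
    simp only [P, q]
    fun_prop
  have hne : (Finset.univ : Finset (F →ₐ[ℚ] ℂ)).Nonempty := by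
    rw [Finset.univ_nonempty_iff]
    exact ⟨(Classical.arbitrary (F →+* ℂ)).toRatAlgHom⟩
  have h0 : ‖P 0‖ < 1 := by
    obtain ⟨φ, hφ⟩ := hne
    have : P 0 = 0 := Finset.prod_eq_zero hφ (by simp [q])
    simp [this]
  obtain ⟨ε, hε, hball⟩ := Metric.isOpen_iff.1 (isOpen_lt hcont continuous_const) 0 h0
  refine ⟨ε, hε, fun c hc => ?_⟩
  have hmem : (fun i => (c i : ℝ)) ∈ Metric.ball (0 : ι → ℝ) ε := by
    rw [mem_ball_zero_iff, pi_norm_lt_iff hε]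
    exact hc
  have := hball hmem
  rw [Set.mem_ofPred_eq, ← hP] at this
  exact_mod_cast this

/-- R is finitely generated over ℤ, and a denominator d in 𝓞 F divides its integer norm, so rational
coefficients suffice. -/
theorem exists_rat_combination {R : Subalgebra (𝓞 F) B} (hR : IsOrder R) :
    ∃ (ι : Type) (_ : Fintype ι) (g : ι → B), (∀ i, g i ∈ R) ∧
      ∀ x : B, ∃ c : ι → ℚ, x = ∑ i, (c i : F) • g i := by
  have : Module.Finite (𝓞 F) (Subalgebra.toSubmodule R) := Module.Finite.iff_fg.2 hR.fg
  have : Module.Finite ℤ (Subalgebra.toSubmodule R) := Module.Finite.trans (𝓞 F) _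
  obtain ⟨n, g, hg⟩ := Module.Finite.exists_fin (R := ℤ) (M := Subalgebra.toSubmodule R)
  refine ⟨Fin n, inferInstance, fun i => g i, fun i => (g i).2, fun x => ?_⟩
  obtain ⟨d, hd, hdx⟩ := exists_nonZeroDivisor_smul_mem hR.span_eq_top x
  obtain ⟨N, hN0, t, ht⟩ : ∃ N : ℤ, N ≠ 0 ∧ ∃ t : 𝓞 F, (N : 𝓞 F) = t * d := by
    refine ⟨Algebra.norm ℤ d, Algebra.norm_ne_zero_iff.2 (nonZeroDivisors.ne_zero hd), ?_⟩
    obtain ⟨t, ht⟩ := Ideal.mem_span_singleton'.1 (Ideal.absNorm_mem (Ideal.span {d}))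
    rw [Ideal.absNorm_span_singleton] at ht
    rcases Int.natAbs_eq (Algebra.norm ℤ d) with h | h
    · exact ⟨t, by rw [h, ht]; simp⟩
    · exact ⟨-t, by rw [h, neg_mul, ht]; simp⟩
  have hNx : (N : 𝓞 F) • x ∈ Subalgebra.toSubmodule R := by
    rw [ht, mul_smul]; exact Submodule.smul_mem _ _ hdx
  obtain ⟨m, hm⟩ := Submodule.mem_span_range_iff_exists_fun ℤ |>.1
    (hg ▸ Submodule.mem_top : (⟨_, hNx⟩ : Subalgebra.toSubmodule R) ∈ Submodule.span ℤ (Set.range g))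
  have hm' := congrArg Subtype.val hm
  rw [AddSubmonoidClass.coe_finsetSum] at hm'
  have hNF : (N : F) ≠ 0 := by exact_mod_cast hN0
  refine ⟨fun i => m i / N, ?_⟩
  have hx : x = (N : F)⁻¹ • ((N : 𝓞 F) • x) := by
    rw [← algebraMap_smul F (N : 𝓞 F), map_intCast, inv_smul_smul₀ hNF]
  rw [hx]
  simp only at hm'
  rw [← hm', Finset.smul_sum]
  refine Finset.sum_congr rfl fun i _ => ?_
  change (N : F)⁻¹ • (m i • (g i : B)) = ((m i / N : ℚ) : F) • (g i : B)
  rw [← Int.cast_smul_eq_zsmul F, smul_smul]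
  congr 1
  push_cast
  rw [div_eq_inv_mul]

/-- Division with small remainder in an order, after multiplication by one of finitely many
integers. -/
theorem exists_approximation (hB : IsQuaternionAlgebra F B) {R : Subalgebra (𝓞 F) B}
    (hR : IsOrder R) : ∃ M : ℕ, ∀ x : B, ∃ k : ℕ, 1 ≤ k ∧ k ≤ M ∧ ∃ r ∈ R,
      absNorm F ((k : F) • x - r) < 1 := by
  obtain ⟨ι, _, g, hg, hspan⟩ := exists_rat_combination hR
  obtain ⟨ε, hε, hsmall⟩ := exists_absNorm_lt_one hB g
  obtain ⟨K, hK⟩ := exists_nat_gt (1 / ε)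
  have hK0 : (0 : ℝ) < K := (one_div_pos.2 hε).trans hK
  have hKε : 1 / (K : ℝ) < ε := by rwa [one_div_lt hK0 hε]
  have hKQ : (0 : ℚ) < K := by exact_mod_cast hK0
  classical
  -- Dirichlet's pigeonhole argument: among the multiples r x with 0 ≤ r ≤ M, where M is the number
  -- of boxes, two have fractional parts of coordinates in the same box of side 1/K. Their
  -- difference, less the integral parts, has coordinates below ε.
  refine ⟨Fintype.card (ι → Fin K), fun x => ?_⟩
  obtain ⟨c, rfl⟩ := hspan x
  let box : Fin (Fintype.card (ι → Fin K) + 1) → ι → Fin K := fun r i =>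
    ⟨⌊(K : ℚ) * Int.fract ((r : ℕ) * c i)⌋₊, by
      rw [Nat.floor_lt (mul_nonneg hKQ.le (Int.fract_nonneg _))]
      exact mul_lt_of_lt_one_right hKQ (Int.fract_lt_one _)⟩
  obtain ⟨r, r', hne, hbox⟩ := Fintype.exists_ne_map_eq_of_card_lt box (by simp)
  wlog hlt : r < r' generalizing r r'
  · exact this r' r hne.symm hbox.symm (lt_of_le_of_ne (not_lt.1 hlt) hne.symm)
  have hlt' : (r : ℕ) < r' := hlt
  refine ⟨r' - r, by lia, by lia,
    ∑ i, (⌊((r' : ℕ) : ℚ) * c i⌋ - ⌊((r : ℕ) : ℚ) * c i⌋) • g i,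
    sum_mem fun i _ => zsmul_mem (hg i) _, ?_⟩
  let δ : ι → ℚ := fun i => Int.fract (((r' : ℕ) : ℚ) * c i) - Int.fract (((r : ℕ) : ℚ) * c i)
  have hδ : ∀ i, |(δ i : ℝ)| < ε := fun i => by
    refine lt_of_le_of_lt ?_ hKε
    have h1 : ⌊(K : ℚ) * Int.fract (((r : ℕ) : ℚ) * c i)⌋₊ =
      ⌊(K : ℚ) * Int.fract (((r' : ℕ) : ℚ) * c i)⌋₊ := congrArg Fin.val (congrFun hbox i)
    have h2 := Nat.floor_le (mul_nonneg hKQ.le (Int.fract_nonneg (((r : ℕ) : ℚ) * c i)))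
    have h3 := Nat.floor_le (mul_nonneg hKQ.le (Int.fract_nonneg (((r' : ℕ) : ℚ) * c i)))
    have h4 := Nat.lt_floor_add_one ((K : ℚ) * Int.fract (((r : ℕ) : ℚ) * c i))
    have h5 := Nat.lt_floor_add_one ((K : ℚ) * Int.fract (((r' : ℕ) : ℚ) * c i))
    rw [h1] at h2 h4
    have h6 : |δ i| ≤ 1 / K := by
      rw [le_div_iff₀ hKQ, ← abs_of_pos hKQ, ← abs_mul, abs_le]
      simp only [δ]
      constructor <;> linarith
    have h7 := (Rat.cast_le (K := ℝ)).2 h6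
    push_cast at h7
    exact h7
  have hsum : ((r' - r : ℕ) : F) • ∑ i, (c i : F) • g i -
      ∑ i, (⌊((r' : ℕ) : ℚ) * c i⌋ - ⌊((r : ℕ) : ℚ) * c i⌋) • g i = ∑ i, (δ i : F) • g i := by
    rw [Finset.smul_sum, ← Finset.sum_sub_distrib]
    refine Finset.sum_congr rfl fun i _ => ?_
    rw [smul_smul, ← Int.cast_smul_eq_zsmul F, ← sub_smul]
    congr 1
    have : δ i = ((r' - r : ℕ) : ℚ) * c i -
        ((⌊((r' : ℕ) : ℚ) * c i⌋ - ⌊((r : ℕ) : ℚ) * c i⌋ : ℤ) : ℚ) := by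
      simp only [δ, Int.fract]
      push_cast [Nat.cast_sub hlt'.le]
      ring
    rw [this]
    push_cast
    rfl
  rw [hsum]
  exact hsmall δ hδ

variable [IsTotallyReal F] {R : Subalgebra (𝓞 F) B} (hB : IsQuaternionAlgebra F B)
  (hdef : IsTotallyDefinite F B) (hR : IsOrder R)
include hB hdef hR

theorem absNorm_pos {x : B} (hx : x ≠ 0) : 0 < absNorm F x :=
  abs_pos.2 (Algebra.norm_ne_zero_iff.2 (reducedNorm_ne_zero hB hdef hx))

/-- An element of minimal norm of an ideal. -/
theorem exists_minimal_absNorm (I : InvIdeal R) : ∃ b : Bˣ, (b : B) ∈ I.carrier ∧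
    ∀ y ∈ I.carrier, absNorm F y < absNorm F (b : B) → y = 0 := by
  classical
  have := hB.nontrivial
  obtain ⟨d, hd, hdI⟩ := exists_nonZeroDivisor_smul_mem_of_fg I.isLattice.fg hR.span_eq_top
  have hd0 : algebraMap (𝓞 F) F d ≠ 0 := by simpa using nonZeroDivisors.ne_zero hd
  have hdB : ∀ y : B, absNorm F (d • y) = absNorm F (d • (1 : B)) * absNorm F y := fun y => by
    rw [← absNorm_mul hB, smul_mul_assoc, one_mul]
  have hd1 : 0 < absNorm F (d • (1 : B)) := absNorm_pos hB hdef hR fun h => by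
    rw [← algebraMap_smul F] at h
    exact (smul_ne_zero hd0 one_ne_zero) h
  -- Norms on I need not be integers, but those on d I ⊆ R are, so the well-ordering of ℕ applies
  -- after scaling by d.
  have hex : ∃ n : ℕ, ∃ y ∈ I.carrier, y ≠ 0 ∧ absNorm F (d • y) = n := by
    obtain ⟨s, hs, hsI⟩ := exists_nonZeroDivisor_smul_mem I.isLattice.span_eq_top (1 : B)
    obtain ⟨n, hn⟩ := exists_nat_eq_absNorm hB hR (hdI _ hsI)
    refine ⟨n, _, hsI, ?_, hn⟩
    rw [← algebraMap_smul F]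
    exact smul_ne_zero (by simpa using nonZeroDivisors.ne_zero hs) one_ne_zero
  obtain ⟨b, hbI, hb0, hbn⟩ := Nat.find_spec hex
  obtain ⟨b, rfl⟩ := isUnit_of_ne_zero hB hdef hb0
  refine ⟨b, hbI, fun y hy hlt => ?_⟩
  by_contra hy0
  obtain ⟨n, hn⟩ := exists_nat_eq_absNorm hB hR (hdI y hy)
  refine Nat.find_min hex (m := n) ?_ ⟨y, hy, hy0, hn⟩
  have : (n : ℚ) < Nat.find hex := by
    rw [← hn, ← hbn, hdB y, hdB b]
    exact mul_lt_mul_of_pos_left hlt hd1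
  exact_mod_cast this

/-- The set `cl(R)` is finite. -/
theorem finite_classSet : Finite (ClassSet R) := by
  obtain ⟨M, hM⟩ := exists_approximation hB hR
  have hfac : ((M.factorial : ℕ) : 𝓞 F) ≠ 0 := by exact_mod_cast M.factorial_ne_zero
  have hfacF : ((M.factorial : ℕ) : F) ≠ 0 := by exact_mod_cast M.factorial_ne_zero
  have hfin := finite_setOf_invIdeal_between (R := R) (Subalgebra.toSubmodule R) hR.fg hfac
  refine Set.finite_univ_iff.1 ((hfin.image InvIdeal.toClass).subset fun c _ => ?_)
  induction c using Quotient.inductionOn with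
  | h I =>
    obtain ⟨b, hb, hmin⟩ := exists_minimal_absNorm hB hdef hR I
    have hmul : ∀ y ∈ I.carrier, ((M.factorial : ℕ) : F) • (y * ((b⁻¹ : Bˣ) : B)) ∈ R := by
      intro y hy
      obtain ⟨k, hk1, hkM, r, hr, hlt⟩ := hM (y * ((b⁻¹ : Bˣ) : B))
      -- This element of I has norm smaller than the minimal one, that of b, so it is 0 and k y b⁻¹
      -- lies in R. As k divides M!, every class is represented by I b⁻¹ M!, which lies between M! R
      -- and R.
      have hzero : (k : F) • y - r * b = 0 := by
        refine hmin _ (sub_mem ?_ (I.mul_le (Submodule.mul_mem_mul hr hb))) ?_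
        · have : (k : F) • y = (k : 𝓞 F) • y := by rw [← algebraMap_smul F (k : 𝓞 F), map_natCast]
          rw [this]; exact I.carrier.smul_mem _ hy
        · have : (k : F) • y - r * b = ((k : F) • (y * ((b⁻¹ : Bˣ) : B)) - r) * b := by
            rw [sub_mul, smul_mul_assoc, Units.inv_mul_cancel_right]
          rw [this, absNorm_mul hB]
          refine mul_lt_of_lt_one_left (absNorm_pos hB hdef hR fun h => ?_) hlt
          have := hB.nontrivial
          exact b.ne_zero h
      obtain ⟨l, hl⟩ := Nat.dvd_factorial hk1 hkM
      have hkr : (k : F) • (y * ((b⁻¹ : Bˣ) : B)) = r := by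
        rw [← smul_mul_assoc, sub_eq_zero.1 hzero, Units.mul_inv_cancel_right]
      have : ((M.factorial : ℕ) : F) • (y * ((b⁻¹ : Bˣ) : B)) = (l : 𝓞 F) • r := by
        rw [hl, mul_comm, Nat.cast_mul, mul_smul, hkr, ← algebraMap_smul F (l : 𝓞 F), map_natCast]
      exact this ▸ R.smul_mem hr _
    let x : Bˣ := b⁻¹ * scalarUnit (Units.mk0 _ hfacF)
    have hx : ∀ y : B, y * (x : B) = ((M.factorial : ℕ) : F) • (y * ((b⁻¹ : Bˣ) : B)) := fun y => by
      rw [Algebra.smul_def, Algebra.commutes, mul_assoc]; rfl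
    refine ⟨I.rmul x, ⟨?_, fun r hr => ?_⟩, Quotient.sound ⟨x, rfl⟩⟩
    · intro z hz
      obtain ⟨y, hy, rfl⟩ := mem_rtrans.1 hz
      rw [hx]
      exact hmul y hy
    · refine mem_rtrans.2 ⟨r * b, I.mul_le (Submodule.mul_mem_mul hr hb), ?_⟩
      rw [hx, Units.mul_inv_cancel_right, ← algebraMap_smul F ((M.factorial : ℕ) : 𝓞 F),
        map_natCast]

end ClassNumber

/-! ### The pairing and the action of the class group -/

section ClassAction

variable {F B : Type*} [Field F] [NumberField F] [Ring B] [Algebra F B]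
variable {R : Subalgebra (𝓞 F) B}

theorem ClassSet.induction {P : ClassSet R → Prop} (h : ∀ I : InvIdeal R, P I.toClass)
    (c : ClassSet R) : P c :=
  Quotient.inductionOn c h

theorem exists_classGroupMk_eq (A : ClassGroup (𝓞 F)) :
    ∃ 𝔞 : (FractionalIdeal (𝓞 F)⁰ F)ˣ, ClassGroup.mk (K := F) 𝔞 = A :=
  ClassGroup.induction (K := F) (fun 𝔞 => ⟨𝔞, rfl⟩) A

theorem classPair_toClass (I J : InvIdeal R) : classPair I.toClass J.toClass = pairCount I J := rfl

theorem toClass_rmul (I : InvIdeal R) (x : Bˣ) : (I.rmul x).toClass = I.toClass :=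
  Quotient.sound ⟨x, rfl⟩

theorem classPair_eq_zero {c d : ClassSet R} (h : c ≠ d) : classPair c d = 0 := by
  induction c using ClassSet.induction with
  | h I =>
  induction d using ClassSet.induction with
  | h J =>
    have : {x : Bˣ | I.rmul x = J} = ∅ := Set.eq_empty_of_forall_notMem fun x hx =>
      h ((toClass_rmul I x).symm.trans (congrArg InvIdeal.toClass hx))
    change Set.ncard _ = 0
    rw [this, Set.image_empty, Set.ncard_empty]

theorem pairCount_eq_self {I J : InvIdeal R} (h : J.toClass = I.toClass) :
    pairCount I J = pairCount I I := by
  rw [← classPair_toClass, h]; rfl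

theorem classAct_mk (𝔞 : (FractionalIdeal (𝓞 F)⁰ F)ˣ) (I : InvIdeal R) :
    classAct R (ClassGroup.mk (K := F) 𝔞) I.toClass = (I.smulIdeal 𝔞).toClass := by
  have h : ClassGroup.equiv F (ClassGroup.mk (K := F) 𝔞) = QuotientGroup.mk 𝔞 := by
    rw [ClassGroup.equiv_mk]
    exact congrArg QuotientGroup.mk (Units.ext (by simp))
  unfold classAct
  simp only [MonoidHom.comp_apply, MulEquiv.toMonoidHom_eq_coe, MonoidHom.coe_coe, h]
  rfl

theorem classAct_inv_classAct (A : ClassGroup (𝓞 F)) (c : ClassSet R) :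
    classAct R A⁻¹ (classAct R A c) = c := by
  change (classAct R A⁻¹ * classAct R A) c = c
  rw [← map_mul, inv_mul_cancel, map_one]
  rfl

theorem classAct_classAct_inv (A : ClassGroup (𝓞 F)) (c : ClassSet R) :
    classAct R A (classAct R A⁻¹ c) = c := by
  simpa using classAct_inv_classAct A⁻¹ c

theorem classPair_classAct (A : ClassGroup (𝓞 F)) (c d : ClassSet R) :
    classPair (classAct R A c) (classAct R A d) = classPair c d := by
  obtain ⟨𝔞, rfl⟩ := exists_classGroupMk_eq A
  induction c using ClassSet.induction with
  | h I =>
  induction d using ClassSet.induction with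
  | h J =>
    rw [classAct_mk, classAct_mk, classPair_toClass, classPair_toClass]
    unfold pairCount
    congr 2
    ext x
    rw [Set.mem_ofPred_eq, Set.mem_ofPred_eq, ← InvIdeal.smulIdeal_rmul]
    refine ⟨fun h => ?_, fun h => h ▸ rfl⟩
    have := congrArg (InvIdeal.smulIdeal 𝔞⁻¹) h
    simpa only [← InvIdeal.smulIdeal_mul, inv_mul_cancel, InvIdeal.smulIdeal_one] using this

variable (hB : IsQuaternionAlgebra F B) (hR : IsOrder R)
include hB hR

variable (R) in
/-- The norm map `cl(R) → cl(F)`. -/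
theorem exists_normMap : ∃ ν : ClassSet R → ClassGroup (𝓞 F), ∀ (I : InvIdeal R)
    (𝔞 : (FractionalIdeal (𝓞 F)⁰ F)ˣ),
    normIdeal I.carrier = ((𝔞 : FractionalIdeal (𝓞 F)⁰ F) : Submodule (𝓞 F) F) →
      ν I.toClass = ClassGroup.mk (K := F) 𝔞 := by
  choose n hn using fun I : InvIdeal R => I.exists_normIdeal_eq hB hR
  have hinj : ∀ {𝔞 𝔟 : (FractionalIdeal (𝓞 F)⁰ F)ˣ},
      ((𝔞 : FractionalIdeal (𝓞 F)⁰ F) : Submodule (𝓞 F) F) =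
        ((𝔟 : FractionalIdeal (𝓞 F)⁰ F) : Submodule (𝓞 F) F) → 𝔞 = 𝔟 := fun h =>
    Units.ext (FractionalIdeal.coeToSubmodule_injective h)
  refine ⟨Quotient.lift (fun I => ClassGroup.mk (K := F) (n I)) ?_, fun I 𝔞 h => ?_⟩
  · rintro I J ⟨x, rfl⟩
    let ξ : Fˣ := Units.mk0 _ (hB.reducedNorm_unit_ne_zero x)
    -- Right translation by x changes the norm by the principal ideal generated by nrd(x), so the
    -- class is well defined.
    have : n (J.rmul x) = toPrincipalIdeal (𝓞 F) F ξ * n J := hinj (by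
      rw [← hn, InvIdeal.normIdeal_rmul hB hR, hn, Units.val_mul, FractionalIdeal.coe_mul,
        coe_toPrincipalIdeal, FractionalIdeal.coe_spanSingleton]
      rfl)
    change ClassGroup.mk (K := F) (n (J.rmul x)) = ClassGroup.mk (K := F) (n J)
    rw [this, map_mul, mul_eq_right, ClassGroup.mk_eq_one_iff]
    exact ⟨(ξ : F), by rw [coe_toPrincipalIdeal, FractionalIdeal.coe_spanSingleton]⟩
  · change ClassGroup.mk (K := F) (n I) = _
    rw [hinj ((hn I).symm.trans h)]

variable {ν : ClassSet R → ClassGroup (𝓞 F)} (hν : ∀ (I : InvIdeal R)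
    (𝔞 : (FractionalIdeal (𝓞 F)⁰ F)ˣ),
    normIdeal I.carrier = ((𝔞 : FractionalIdeal (𝓞 F)⁰ F) : Submodule (𝓞 F) F) →
      ν I.toClass = ClassGroup.mk (K := F) 𝔞)
include hν

theorem mem_normClass_iff {A : ClassGroup (𝓞 F)} {c : ClassSet R} : c ∈ normClass R A ↔ ν c = A := by
  constructor
  · rintro ⟨I, rfl, 𝔞, h𝔞, rfl⟩
    exact hν I 𝔞 h𝔞
  · rintro rfl
    induction c using ClassSet.induction with
    | h I =>
      obtain ⟨𝔞, h𝔞⟩ := I.exists_normIdeal_eq hB hR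
      exact ⟨I, rfl, 𝔞, h𝔞, (hν I 𝔞 h𝔞).symm⟩

theorem normMap_classAct (A : ClassGroup (𝓞 F)) (c : ClassSet R) :
    ν (classAct R A c) = A ^ 2 * ν c := by
  obtain ⟨𝔞, rfl⟩ := exists_classGroupMk_eq A
  induction c using ClassSet.induction with
  | h I =>
    obtain ⟨𝔟, h𝔟⟩ := I.exists_normIdeal_eq hB hR
    rw [classAct_mk, hν I 𝔟 h𝔟, ← map_pow, ← map_mul]
    refine hν _ _ ?_
    rw [InvIdeal.normIdeal_smulIdeal hB hR, h𝔟, sq, Units.val_mul, Units.val_mul,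
      FractionalIdeal.coe_mul, FractionalIdeal.coe_mul]

theorem normMap_of_mem_heckeSet {𝔪 : Ideal (𝓞 F)} (h𝔪 : 𝔪 ≠ ⊥)
    {𝔞 : (FractionalIdeal (𝓞 F)⁰ F)ˣ}
    (h𝔞 : ((𝔞 : FractionalIdeal (𝓞 F)⁰ F) : Submodule (𝓞 F) F) =
      Submodule.map (Algebra.linearMap (𝓞 F) F) 𝔪) {I J : InvIdeal R} (h : J ∈ heckeSet 𝔪 I) :
    ν J.toClass = ClassGroup.mk (K := F) 𝔞 * ν I.toClass := by
  obtain ⟨𝔟, h𝔟⟩ := I.exists_normIdeal_eq hB hR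
  rw [hν I 𝔟 h𝔟, ← map_mul]
  refine hν _ _ ?_
  rw [((mem_heckeSet_iff hB hR h𝔪).1 h).2, h𝔟, Units.val_mul, FractionalIdeal.coe_mul, h𝔞]

end ClassAction

/-! ### The matrix of `T_𝔪` -/

section HeckeMatrix

variable {F B : Type*} [Field F] [NumberField F] [Ring B] [Algebra F B]
variable {R : Subalgebra (𝓞 F) B}

theorem rmul_integerUnit (I : InvIdeal R) {x : Bˣ} (hx : x ∈ integerUnits F B) : I.rmul x = I := by
  have key : ∀ u : (𝓞 F)ˣ, ∀ y ∈ I.carrier,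
      y * (Units.map (algebraMap (𝓞 F) B : 𝓞 F →* B) u : Bˣ) ∈ I.carrier := fun u y hy => by
    change y * algebraMap (𝓞 F) B u ∈ _
    rw [← Algebra.commutes, ← Algebra.smul_def]
    exact I.carrier.smul_mem _ hy
  obtain ⟨u, rfl⟩ := hx
  refine InvIdeal.ext (le_antisymm ?_ fun y hy => ?_)
  · intro z hz
    obtain ⟨y, hy, rfl⟩ := mem_rtrans.1 hz
    exact key u y hy
  · refine (mem_rtrans_unit _).2 ?_
    rw [← map_inv]
    exact key u⁻¹ y hy

theorem rmul_eq_of_mk_eq (I : InvIdeal R) {x y : Bˣ}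
    (h : (QuotientGroup.mk x : Bˣ ⧸ integerUnits F B) = QuotientGroup.mk y) :
    I.rmul x = I.rmul y := by
  rw [QuotientGroup.eq] at h
  have := rmul_integerUnit (I.rmul x) h
  rw [InvIdeal.rmul_rmul, mul_inv_cancel_left] at this
  exact this.symm

theorem heckeOp_single (𝔪 : Ideal (𝓞 F)) (I : InvIdeal R) (a : ℂ) :
    heckeOp R 𝔪 (Finsupp.single I.toClass a) = a • heckeSum 𝔪 I :=
  Finsupp.linearCombination_single ℂ a I.toClass

variable [IsTotallyReal F] (hB : IsQuaternionAlgebra F B)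
  (hdef : IsTotallyDefinite F B) (hR : IsOrder R) {𝔪 : Ideal (𝓞 F)} (h𝔪 : 𝔪 ≠ ⊥)
include hB hR h𝔪

theorem heckeSum_eq_sum (I : InvIdeal R) : heckeSum 𝔪 I =
    ∑ J ∈ (finite_heckeSet hB hR h𝔪 I).toFinset, Finsupp.single J.toClass 1 :=
  finsum_mem_eq_finite_toFinset_sum _ _

theorem heckeSum_apply (I : InvIdeal R) (d : ClassSet R) :
    heckeSum 𝔪 I d = ({K | K ∈ heckeSet 𝔪 I ∧ K.toClass = d}.ncard : ℂ) := by
  classical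
  rw [heckeSum_eq_sum hB hR h𝔪, Finsupp.finsetSum_apply]
  simp only [Finsupp.single_apply]
  rw [Finset.sum_boole, ← Set.ncard_coe_finset]
  congr 2
  ext K
  simp

include hdef

/-- The cosets are sorted by the ideal K = J x; each K in the class of J is reached by ⟨[J], [K]⟩ =
⟨[J], [J]⟩ of them. This turns a matrix entry of T_𝔪 times ⟨[J], [J]⟩ into a single count. -/
theorem ncard_setOf_rmul_mem_heckeSet (I J : InvIdeal R) :
    ((QuotientGroup.mk : Bˣ → Bˣ ⧸ integerUnits F B) '' {x | J.rmul x ∈ heckeSet 𝔪 I}).ncard =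
      {K | K ∈ heckeSet 𝔪 I ∧ K.toClass = J.toClass}.ncard * pairCount J J := by
  set T := {K | K ∈ heckeSet 𝔪 I ∧ K.toClass = J.toClass}
  have hT : T.Finite := (finite_heckeSet hB hR h𝔪 I).subset fun K hK => hK.1
  let f : InvIdeal R → Set (Bˣ ⧸ integerUnits F B) := fun K =>
    QuotientGroup.mk '' {x | J.rmul x = K}
  have hf : ∀ K ∈ T, (f K).ncard = pairCount J J := fun K hK => pairCount_eq_self hK.2
  have hfin : ∀ K ∈ T, (f K).Finite := fun K hK =>
    Set.finite_of_ncard_ne_zero (by rw [hf K hK]; exact pairCount_self_ne_zero hB hdef hR J)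
  have hdisj : T.PairwiseDisjoint f := by
    intro K _ K' _ hne
    refine Set.disjoint_left.2 ?_
    rintro _ ⟨x, rfl, rfl⟩ ⟨y, rfl, hxy⟩
    exact hne (rmul_eq_of_mk_eq J hxy.symm)
  have hunion : (QuotientGroup.mk : Bˣ → Bˣ ⧸ integerUnits F B) ''
      {x | J.rmul x ∈ heckeSet 𝔪 I} = ⋃ K ∈ T, f K := by
    ext c
    simp only [Set.mem_iUnion]
    constructor
    · rintro ⟨x, hx, rfl⟩
      exact ⟨J.rmul x, ⟨hx, toClass_rmul J x⟩, x, rfl, rfl⟩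
    · rintro ⟨K, hK, x, rfl, rfl⟩
      exact ⟨x, hK.1, rfl⟩
  rw [hunion, hT.ncard_biUnion hfin hdisj, finsum_mem_eq_finite_toFinset_sum _ hT,
    Finset.sum_congr rfl fun K hK => hf K (hT.mem_toFinset.1 hK), Finset.sum_const, smul_eq_mul,
    Set.ncard_eq_toFinset_card _ hT]

/-- The adjoint of `T_𝔪` is `[𝔪]⁻¹ T_𝔪`. -/
theorem classPair_mul_heckeOp {𝔞 : (FractionalIdeal (𝓞 F)⁰ F)ˣ}
    (h𝔞 : ((𝔞 : FractionalIdeal (𝓞 F)⁰ F) : Submodule (𝓞 F) F) =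
      Submodule.map (Algebra.linearMap (𝓞 F) F) 𝔪) (c d : ClassSet R) :
    (classPair d d : ℂ) * heckeOp R 𝔪 (Finsupp.single c 1) d =
      classPair c c * heckeOp R 𝔪 (Finsupp.single d 1)
        (classAct R (ClassGroup.mk (K := F) 𝔞) c) := by
  rw [← classPair_classAct (ClassGroup.mk (K := F) 𝔞) c c]
  induction c using ClassSet.induction with
  | h I =>
  induction d using ClassSet.induction with
  | h J =>
    rw [classAct_mk, heckeOp_single, heckeOp_single, one_smul, one_smul,
      heckeSum_apply hB hR h𝔪, heckeSum_apply hB hR h𝔪, classPair_toClass, classPair_toClass]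
    norm_cast
    rw [mul_comm, mul_comm (pairCount _ _), ← ncard_setOf_rmul_mem_heckeSet hB hdef hR h𝔪,
      ← ncard_setOf_rmul_mem_heckeSet hB hdef hR h𝔪]
    -- Both sides now count cosets, and x ↦ x⁻¹ exchanges the two sets, since J x ∈ t_𝔪(I) exactly
    -- when 𝔪I x⁻¹ ∈ t_𝔪(J).
    have : (QuotientGroup.mk : Bˣ → Bˣ ⧸ integerUnits F B) ''
        {x | (I.smulIdeal 𝔞).rmul x ∈ heckeSet 𝔪 J} =
        (fun c => c⁻¹) '' ((QuotientGroup.mk : Bˣ → Bˣ ⧸ integerUnits F B) ''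
          {x | J.rmul x ∈ heckeSet 𝔪 I}) := by
      rw [Set.image_image]
      ext c
      constructor
      · rintro ⟨x, hx, rfl⟩
        refine ⟨x⁻¹, (rmul_mem_heckeSet_iff hB hR h𝔪 h𝔞 _).2 ?_, by simp⟩
        rwa [inv_inv]
      · rintro ⟨x, hx, rfl⟩
        exact ⟨x⁻¹, (rmul_mem_heckeSet_iff hB hR h𝔪 h𝔞 _).1 hx, by simp⟩
    rw [this, Set.ncard_image_of_injective _ inv_injective]

end HeckeMatrix

/-! ### Eisenstein space and cusp forms -/

section Decomposition

variable {F B : Type*} [Field F] [NumberField F] [Ring B] [Algebra F B]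
variable {R : Subalgebra (𝓞 F) B}

open scoped Classical in
/-- The sum of the coefficients at the classes with norm in `A`. -/
def normSum (ν : ClassSet R → ClassGroup (𝓞 F)) (A : ClassGroup (𝓞 F)) : ModularForms R →ₗ[ℂ] ℂ :=
  Finsupp.linearCombination ℂ fun c => if ν c = A then 1 else 0

theorem normSum_single (ν : ClassSet R → ClassGroup (𝓞 F)) (A : ClassGroup (𝓞 F))
    (c : ClassSet R) (a : ℂ) [Decidable (ν c = A)] :
    normSum ν A (Finsupp.single c a) = if ν c = A then a else 0 := by
  rw [normSum, Finsupp.linearCombination_single]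
  split_ifs <;> simp

theorem normSum_eq_sum [Fintype (ClassSet R)] (ν : ClassSet R → ClassGroup (𝓞 F))
    (A : ClassGroup (𝓞 F)) [∀ c, Decidable (ν c = A)] (v : ModularForms R) :
    normSum ν A v = ∑ c, if ν c = A then v c else 0 := by
  rw [normSum, Finsupp.linearCombination_apply, Finsupp.sum_fintype _ _ (by simp)]
  refine Finset.sum_congr rfl fun c _ => ?_
  split_ifs <;> simp

variable [IsTotallyReal F] (hB : IsQuaternionAlgebra F B)
  (hdef : IsTotallyDefinite F B) (hR : IsOrder R)
variable {ν : ClassSet R → ClassGroup (𝓞 F)} (hν : ∀ (I : InvIdeal R)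
    (𝔞 : (FractionalIdeal (𝓞 F)⁰ F)ˣ),
    normIdeal I.carrier = ((𝔞 : FractionalIdeal (𝓞 F)⁰ F) : Submodule (𝓞 F) F) →
      ν I.toClass = ClassGroup.mk (K := F) 𝔞)
include hB hdef hR

theorem classPair_self_ne_zero (c : ClassSet R) : (classPair c c : ℂ) ≠ 0 := by
  induction c using ClassSet.induction with
  | h I => exact Nat.cast_ne_zero.2 (pairCount_self_ne_zero hB hdef hR I)

include hν

/-- Finiteness of cl(R) is needed because a `finsum` with infinite support is 0. -/
theorem eisVector_apply (A : ClassGroup (𝓞 F)) (c : ClassSet R) [Decidable (ν c = A)] :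
    eisVector R A c = if ν c = A then 1 / (classPair c c : ℂ) else 0 := by
  classical
  have := finite_classSet hB hdef hR
  rw [eisVector, finsum_mem_eq_finite_toFinset_sum _ (Set.toFinite _), Finsupp.finsetSum_apply]
  simp only [Finsupp.single_apply, Finset.sum_ite_eq', Set.Finite.mem_toFinset,
    mem_normClass_iff hB hR hν]

/-- The basis is orthogonal, so the weight 1 / ⟨c, c⟩ cancels the only surviving pairing ⟨c, c⟩.
This cancellation is where its nonvanishing is used. -/
theorem innerForm_eisVector (A : ClassGroup (𝓞 F)) (v : ModularForms R) :
    innerForm R (eisVector R A) v = normSum ν A v := by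
  classical
  have := finite_classSet hB hdef hR
  have : Fintype (ClassSet R) := Fintype.ofFinite _
  suffices h : innerForm R (eisVector R A) = normSum ν A by rw [h]
  refine Finsupp.lhom_ext fun d a => ?_
  rw [normSum_single]
  change ((eisVector R A).sum fun c a' => (Finsupp.single d a).sum fun d b =>
    starRingEnd ℂ a' * b * (classPair c d : ℂ)) = _
  rw [Finsupp.sum_fintype _ _ (by simp), Finset.sum_eq_single d]
  · rw [Finsupp.sum_single_index (by simp), eisVector_apply hB hdef hR hν]
    split_ifs
    · have := classPair_self_ne_zero hB hdef hR d
      simp only [map_div₀, map_one, map_natCast]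
      field_simp
    · simp
  · intro c _ hc
    rw [Finsupp.sum_single_index (by simp), classPair_eq_zero hc]
    simp
  · simp

theorem mem_cuspSpace_iff {v : ModularForms R} :
    v ∈ cuspSpace R ↔ ∀ A, normSum ν A v = 0 := by
  simp only [← innerForm_eisVector hB hdef hR hν]
  refine ⟨fun h A => h _ (Submodule.subset_span ⟨A, rfl⟩), fun h w hw => ?_⟩
  induction hw using Submodule.span_induction with
  | mem w hw => obtain ⟨A, rfl⟩ := hw; exact h A
  | zero => rw [map_zero, LinearMap.zero_apply]
  | add w w' _ _ hw hw' => rw [map_add, LinearMap.add_apply, hw, hw', add_zero]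
  | smul t w _ hw => rw [map_smulₛₗ, LinearMap.smul_apply, hw, smul_zero]

/-- The action of `cl(F)` on the sums of coefficients. -/
theorem normSum_classOp (A C : ClassGroup (𝓞 F)) (v : ModularForms R) :
    normSum ν C (classOp R A v) = normSum ν ((A ^ 2)⁻¹ * C) v := by
  classical
  suffices h : (normSum ν C).comp (classOp R A) = normSum ν ((A ^ 2)⁻¹ * C) from
    LinearMap.congr_fun h v
  refine Finsupp.lhom_ext fun c a => ?_
  have h : classOp R A (Finsupp.single c a) = Finsupp.single (classAct R A c) a :=
    Finsupp.mapDomain_single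
  rw [LinearMap.comp_apply, h, normSum_single, normSum_single, normMap_classAct hB hR hν]
  simp only [eq_inv_mul_iff_mul_eq]

theorem classOp_eisVector (A C : ClassGroup (𝓞 F)) :
    classOp R A (eisVector R C) = eisVector R (A ^ 2 * C) := by
  classical
  ext d
  obtain ⟨c, rfl⟩ : ∃ c, classAct R A c = d := ⟨_, classAct_classAct_inv A d⟩
  have h : classOp R A (eisVector R C) (classAct R A c) = eisVector R C c :=
    Finsupp.mapDomain_apply (Function.LeftInverse.injective (classAct_inv_classAct A)) _ _
  rw [h, eisVector_apply hB hdef hR hν, eisVector_apply hB hdef hR hν, normMap_classAct hB hR hν,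
    classPair_classAct]
  simp only [mul_right_inj]

variable {𝔪 : Ideal (𝓞 F)} (h𝔪 : 𝔪 ≠ ⊥) {𝔞 : (FractionalIdeal (𝓞 F)⁰ F)ˣ}
    (h𝔞 : ((𝔞 : FractionalIdeal (𝓞 F)⁰ F) : Submodule (𝓞 F) F) =
      Submodule.map (Algebra.linearMap (𝓞 F) F) 𝔪)
include h𝔪 h𝔞

/-- The action of `T_𝔪` on the sums of coefficients. -/
theorem exists_normSum_heckeOp : ∃ n : ℂ, ∀ (A : ClassGroup (𝓞 F)) (v : ModularForms R),
    normSum ν A (heckeOp R 𝔪 v) = n * normSum ν ((ClassGroup.mk (K := F) 𝔞)⁻¹ * A) v := by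
  classical
  by_cases hne : Nonempty (InvIdeal R)
  swap
  -- The constant is the size of t_𝔪(I₀) for some I₀; without any ideal, M(R) is zero and every
  -- constant works.
  · have : IsEmpty (ClassSet R) := ⟨fun c => Quotient.inductionOn c fun I => hne ⟨I⟩⟩
    exact ⟨0, fun A v => by rw [Subsingleton.elim v 0]; simp⟩
  obtain ⟨I₀⟩ := hne
  refine ⟨(heckeSet 𝔪 I₀).ncard, fun A v => ?_⟩
  suffices h : (normSum ν A).comp (heckeOp R 𝔪) =
      ((heckeSet 𝔪 I₀).ncard : ℂ) • normSum ν ((ClassGroup.mk (K := F) 𝔞)⁻¹ * A) from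
    LinearMap.congr_fun h v
  refine Finsupp.lhom_ext fun c a => ?_
  induction c using ClassSet.induction with
  | h I =>
    rw [LinearMap.comp_apply, LinearMap.smul_apply, heckeOp_single, heckeSum_eq_sum hB hR h𝔪, map_smul, map_sum, normSum_single,
      Finset.sum_congr rfl fun J hJ => by
        rw [normSum_single, normMap_of_mem_heckeSet hB hR hν h𝔪 h𝔞
          ((Set.Finite.mem_toFinset _).1 hJ)],
      Finset.sum_const, ← Set.ncard_eq_toFinset_card _ (finite_heckeSet hB hR h𝔪 I),
      ncard_heckeSet_eq hB hR h𝔪 I I₀]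
    simp only [eq_inv_mul_iff_mul_eq, smul_eq_mul, nsmul_eq_mul]
    split_ifs <;> ring

/-- By adjointness, ⟨d, d⟩ times the coefficient of T_𝔪 e_A at d is the sum of the coefficients of
T_𝔪 d at the classes [𝔪]c with ν c = A. These are the classes of norm M²A, so the sum is ℓ_{M²A}(T_𝔪
d) = n ℓ_{MA}(d). -/
theorem exists_heckeOp_eisVector : ∃ n : ℂ, ∀ A : ClassGroup (𝓞 F),
    heckeOp R 𝔪 (eisVector R A) = n • eisVector R (ClassGroup.mk (K := F) 𝔞 * A) := by
  classical
  have := finite_classSet hB hdef hR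
  have : Fintype (ClassSet R) := Fintype.ofFinite _
  obtain ⟨n, hn⟩ := exists_normSum_heckeOp hB hdef hR hν h𝔪 h𝔞
  refine ⟨n, fun A => ?_⟩
  set M := ClassGroup.mk (K := F) 𝔞
  ext d
  have hd := classPair_self_ne_zero hB hdef hR d
  refine mul_left_cancel₀ hd ?_
  have hexp : heckeOp R 𝔪 (eisVector R A) d =
      ∑ c, eisVector R A c * heckeOp R 𝔪 (Finsupp.single c 1) d := by
    conv_lhs => rw [← Finsupp.univ_sum_single (eisVector R A)]
    rw [map_sum, Finsupp.finsetSum_apply]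
    refine Finset.sum_congr rfl fun c _ => ?_
    rw [← smul_eq_mul, ← Finsupp.smul_apply, ← map_smul, Finsupp.smul_single, smul_eq_mul, mul_one]
  have hsum : (classPair d d : ℂ) * heckeOp R 𝔪 (eisVector R A) d =
      normSum ν (M ^ 2 * A) (heckeOp R 𝔪 (Finsupp.single d 1)) := by
    -- The action of [𝔪] reindexes the sum, taking the classes of norm A onto those of norm M²A.
    let e : ClassSet R ≃ ClassSet R :=
      ⟨classAct R M, classAct R M⁻¹, classAct_inv_classAct M, classAct_classAct_inv M⟩
    rw [hexp, Finset.mul_sum, normSum_eq_sum]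
    refine (Finset.sum_congr rfl fun c _ => ?_).trans (e.sum_comp fun c =>
      if ν c = M ^ 2 * A then heckeOp R 𝔪 (Finsupp.single d 1) c else 0)
    change _ = if ν (classAct R M c) = _ then _ else _
    rw [mul_left_comm, classPair_mul_heckeOp hB hdef hR h𝔪 h𝔞, eisVector_apply hB hdef hR hν,
      normMap_classAct hB hR hν]
    simp only [mul_right_inj]
    split_ifs
    · rw [← mul_assoc, one_div_mul_cancel (classPair_self_ne_zero hB hdef hR c), one_mul]
      rfl
    · rw [zero_mul]
  rw [hsum, hn, normSum_single, Finsupp.smul_apply, eisVector_apply hB hdef hR hν]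
  have hiff : ν d = M⁻¹ * (M ^ 2 * A) ↔ ν d = M * A := by
    rw [sq, mul_assoc, inv_mul_cancel_left]
  simp only [hiff, smul_eq_mul]
  split_ifs
  · field_simp
  · simp

end Decomposition

/-! ### Eichler orders are lattices; the theorem -/

/-- Being an intersection of maximal orders is used only to know that R is a lattice: a submodule of
a Noetherian module is finitely generated, and the product of denominators for the two orders is one
for their intersection. -/
theorem IsEichlerOrder.isOrder {F B : Type*} [Field F] [NumberField F] [Ring B] [Algebra F B]
    [Module.Finite F B] {R : Subalgebra (𝓞 F) B} (hR : IsEichlerOrder R) : IsOrder R := by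
  obtain ⟨R₁, R₂, h₁, h₂, rfl⟩ := hR
  have h₁ : Submodule.IsLattice F (Subalgebra.toSubmodule R₁) := h₁.1
  have h₂ : Submodule.IsLattice F (Subalgebra.toSubmodule R₂) := h₂.1
  have hfg : (Subalgebra.toSubmodule (R₁ ⊓ R₂)).FG := by
    have : IsNoetherian (𝓞 F) (Subalgebra.toSubmodule R₁) :=
      isNoetherian_of_fg_of_noetherian _ h₁.fg
    exact isNoetherian_submodule.1 this _ fun x hx => hx.1
  refine ⟨hfg, eq_top_iff.2 fun b _ => ?_⟩
  obtain ⟨s, hs, hsb⟩ := exists_nonZeroDivisor_smul_mem h₁.span_eq_top b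
  obtain ⟨t, ht, htb⟩ := exists_nonZeroDivisor_smul_mem h₂.span_eq_top b
  have h0 : algebraMap (𝓞 F) F (s * t) ≠ 0 := by
    simpa using ⟨nonZeroDivisors.ne_zero hs, nonZeroDivisors.ne_zero ht⟩
  have hb : b = (algebraMap (𝓞 F) F (s * t))⁻¹ • ((s * t) • b) := by
    rw [← algebraMap_smul F (s * t), inv_smul_smul₀ h0]
  rw [hb]
  refine Submodule.smul_mem _ _ (Submodule.subset_span ⟨?_, ?_⟩)
  · rw [mul_comm, mul_smul]; exact R₁.smul_mem hsb t
  · rw [mul_smul]; exact R₂.smul_mem htb s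

end QuatForms

end

theorem proposition2 {F B : Type*} [Field F] [NumberField F] [IsTotallyReal F]
    [Ring B] [Algebra F B]
    (hB : QuatForms.IsQuaternionAlgebra F B) (hdef : QuatForms.IsTotallyDefinite F B)
    (R : Subalgebra (𝓞 F) B) (hR : QuatForms.IsEichlerOrder R) :
    (∀ 𝔪 : Ideal (𝓞 F), 𝔪 ≠ ⊥ →
      (∀ v ∈ QuatForms.eisSpace R, QuatForms.heckeOp R 𝔪 v ∈ QuatForms.eisSpace R) ∧
      (∀ v ∈ QuatForms.cuspSpace R, QuatForms.heckeOp R 𝔪 v ∈ QuatForms.cuspSpace R)) ∧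
    (∀ A : ClassGroup (𝓞 F),
      (∀ v ∈ QuatForms.eisSpace R, QuatForms.classOp R A v ∈ QuatForms.eisSpace R) ∧
      (∀ v ∈ QuatForms.cuspSpace R, QuatForms.classOp R A v ∈ QuatForms.cuspSpace R)) := by
  have := hB.moduleFinite
  have hR := hR.isOrder
  obtain ⟨ν, hν⟩ := QuatForms.exists_normMap R hB hR
  have heis : ∀ T : Module.End ℂ (QuatForms.ModularForms R),
      (∀ A, T (QuatForms.eisVector R A) ∈ QuatForms.eisSpace R) →
        ∀ v ∈ QuatForms.eisSpace R, T v ∈ QuatForms.eisSpace R := fun T hT v hv => by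
    have hle : QuatForms.eisSpace R ≤ (QuatForms.eisSpace R).comap T :=
      Submodule.span_le.2 (by rintro _ ⟨A, rfl⟩; exact hT A)
    exact hle hv
  refine ⟨fun 𝔪 h𝔪 => ?_, fun A => ⟨heis _ fun C => ?_, fun v hv => ?_⟩⟩
  · obtain ⟨𝔞, h𝔞⟩ := QuatForms.exists_fractionalIdeal_eq_map (F := F) h𝔪
    obtain ⟨n, hn⟩ := QuatForms.exists_heckeOp_eisVector hB hdef hR hν h𝔪 h𝔞
    obtain ⟨m, hm⟩ := QuatForms.exists_normSum_heckeOp hB hdef hR hν h𝔪 h𝔞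
    refine ⟨heis _ fun A => ?_, fun v hv => ?_⟩
    · rw [hn]
      exact Submodule.smul_mem _ _ (Submodule.subset_span ⟨_, rfl⟩)
    · rw [QuatForms.mem_cuspSpace_iff hB hdef hR hν] at hv ⊢
      intro A
      rw [hm, hv, mul_zero]
  · rw [QuatForms.classOp_eisVector hB hdef hR hν]
    exact Submodule.subset_span ⟨_, rfl⟩
  · rw [QuatForms.mem_cuspSpace_iff hB hdef hR hν] at hv ⊢
    intro C
    rw [QuatForms.normSum_classOp hB hdef hR hν, hv]
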